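/- Let $G$ be the coupling graph of the icosidodecahedron: its $N=30$ sites are the vertices of the polyhedron and neighbours are joined by an edge. Number the sites $1,\dots,30$ so that the edges are: the edges of the pentagons $(1,2,3,4,5)$ and $(26,27,28,29,30)$ and of the decagon $(11,12,\dots,20)$, all read cyclically; the site $5+i$ ($1\le i\le 5$) is joined to $i$ and $i+1$ (to $5$ and $1$ for $i=5$), and the sites $6,7,8,9,10$ are moreover joined to $\{20,11\},\{12,13\},\{14,15\},\{16,17\},\{18,19\}$, respectively; the sites $21,22,23,24,25$ are joined to $\{11,12\},\{13,14\},\{15,16\},\{17,18\},\{19,20\}$ and to $\{26,27\},\{27,28\},\{28,29\},\{29,30\},\{30,26\}$, respectively. For $s\in\{\tfrac12,1,\tfrac32,\dots\}$ let $H=\frac12\sum_{(u,v)}\vec s(u)\cdot\vec s(v)$ be the Heisenberg Hamiltonian on $\bigotimes_{u}\mathbb C^{2s+1}$ with $J=1$ and zero magnetic field; the sum runs over ordered pairs of neighbours. Let $\mathcal H_a$ be the eigenspace of $S_z$ with eigenvalue $Ns-a$, let $H_a$ be the restriction of $H$ to $\mathcal H_a$ and $E_a$ its least eigenvalue. For distinct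 sites let $|n_1,\dots,n_a\rangle$ be the product state with magnetic quantum number $s-1$ at $n_1,\dots,n_a$ and $s$ at all other sites; it is isolated if no two of the $n_i$ are neighbours, and $\mathcal H_a^{iso}\subset\mathcal H_a$ is the span of the isolated states. An 8-loop is an 8-cycle in $G$ which runs through the vertices of two pentagons with a common vertex, except for that vertex. The distance of two loops is the minimal graph distance of their sites. (i) $G$ is regular of degree $j=4$, its symmetry group $\mathcal Y_h$ (the permutations of the vertices which preserve all Euclidean distances) has order $120$, and the least eigenvalue of the adjacency matrix is $-2$. (ii) For every $s$: $E_0=60s^2$; the eigenvalues of $H_1$ are the numbers $60s^2+(x-4)s$, where $x$ runs through the adjacency eigenvalues; hence $E_1=60s^2-6s$, and this eigenvalue of $H_1$ is ten-fold degenerate. For every 8-loop the state $\sum_n\epsilon_n|n\rangle$ with amplitudes $\epsilon_n=\pm1$ that alternate along the loop is an eigenstate with this energy. (iii) For every $s$ and any two 8-loops $L_1,L_2$ with distance $2$, with amplitudes $\epsilon_{n}=\pm1$ and $\delta_{n}=\pm1$ that alternate along $L_1$ and $L_2$, the state $\Phi_2=\sum_{n_1\in L_1,n_2\in L_2}\epsilon_{n_1}\delta_{n_2}|n_1,n_2\rangle$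 lies in $\mathcal H_2^{iso}$ and is an eigenstate of $H$ with energy $60s^2-12s$. Two such loops are $(1,2,3,4,9,17,18,10)$ and $(12,13,22,28,29,30,26,21)$. (iv) Consider the following representatives $(n_1,n_2,n_3)$, each followed by the length of its $\mathcal Y_h$-orbit and an amplitude: $(1,3,14)$: $60$, $1$; $(1,3,15)$: $120$, $-1$; $(1,3,22)$: $120$, $-1$; $(1,3,23)$: $120$, $1$; $(1,3,28)$: $120$, $1$; $(1,3,29)$: $60$, $-2$; $(1,7,15)$: $120$, $1$; $(1,7,18)$: $60$, $1$; $(1,7,23)$: $120$, $-1$; $(1,7,24)$: $120$, $-1$; $(1,7,29)$: $60$, $2$; $(1,8,21)$: $120$, $-1$; $(1,8,25)$: $30$, $2$; $(1,8,26)$: $120$, $-1$; $(1,8,27)$: $120$, $2$; $(1,8,28)$: $30$, $-2$; $(1,13,16)$: $20$, $-2$; $(1,13,24)$: $60$, $-1$; $(1,13,30)$: $60$, $2$; $(1,14,30)$: $20$, $-1$. The orbit lengths are as stated and the orbits are pairwise disjoint. For every $s$, let $\Phi_3=\sum_T c_T|T\rangle$, where the sum runs over the sets $T$ of three sites, $c_T$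 is the amplitude of the representative whose orbit contains $T$, and $c_T=0$ if there is none. Then $\Phi_3$ is $\mathcal Y_h$-invariant, lies in $\mathcal H_3^{iso}$, and is an eigenstate of $H$ with energy $60s^2-18s$. (v) For $s=\tfrac12$ these energies are the ground-state energies of their sectors: for $a=0,1,2,3$ one has $E_a=60s^2-6sa$, and this is also the minimal energy $E_{min}(S)$ for total spin quantum number $S=30s-a$. So the last four points of the graph of $E_{min}$ versus $S$ lie on a straight line. -/

import Mathlib

open scoped BigOperators

namespace HighSpin

noncomputable section

/-! ### Heisenberg spin systems on a graph, spin quantum number `s = n / 2`, coupling `J = 1` -/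

section Spin

/-- The matrix of `s⁻` in the basis `|0⟩, …, |n⟩`, where `|k⟩` is the state of a single spin
`s = n / 2` with magnetic quantum number `m = n / 2 - k`:
`s⁻ |k⟩ = √((s + m) (s - m + 1)) |k + 1⟩ = √((n - k) (k + 1)) |k + 1⟩`. -/
def lowering (n : ℕ) : Matrix (Fin (n + 1)) (Fin (n + 1)) ℂ :=
  Matrix.of fun i k =>
    if i.val = k.val + 1 then ((Real.sqrt (((n : ℝ) - k.val) * (k.val + 1)) : ℝ) : ℂ) else 0

/-- The matrix of `s⁺`, the adjoint of `s⁻`. -/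
def raising (n : ℕ) : Matrix (Fin (n + 1)) (Fin (n + 1)) ℂ := (lowering n).conjTranspose

/-- The spin matrices `s_x, s_y, s_z` of a single spin `s = n / 2`. -/
def spinMatrix (n : ℕ) : Fin 3 → Matrix (Fin (n + 1)) (Fin (n + 1)) ℂ :=
  ![(1 / 2 : ℂ) • (raising n + lowering n),
    (1 / (2 * Complex.I) : ℂ) • (raising n - lowering n),
    Matrix.diagonal fun k => (n : ℂ) / 2 - k.val]

/-- The state space of spins `s = n / 2` on the sites `V`: amplitudes with respect to the product
basis, which is indexed by the maps `V → Fin (n + 1)`. -/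
abbrev State (V : Type) (n : ℕ) : Type := (V → Fin (n + 1)) → ℂ

variable {V : Type} [Fintype V] [DecidableEq V]

/-- The operator which acts as the matrix `A` on the spin at the site `u` and as the identity on
the other spins. -/
def siteOp {n : ℕ} (u : V) (A : Matrix (Fin (n + 1)) (Fin (n + 1)) ℂ) :
    State V n →ₗ[ℂ] State V n where
  toFun Ψ := fun σ => ∑ k, A (σ u) k * Ψ (Function.update σ u k)
  map_add' Ψ Φ := by
    funext σ
    simp [mul_add, Finset.sum_add_distrib]
  map_smul' c Ψ := by
    funext σ
    simp only [Pi.smul_apply, smul_eq_mul, RingHom.id_apply, Finset.mul_sum]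
    exact Finset.sum_congr rfl fun k _ => by ring

/-- The Heisenberg Hamiltonian `(1/2) ∑_{(u,v)} s(u) · s(v)` (with `J = 1` and without magnetic
field); the sum runs over ordered pairs of neighbours, so that every bond is counted twice. -/
def hamiltonian (G : SimpleGraph V) [DecidableRel G.Adj] (n : ℕ) :
    State V n →ₗ[ℂ] State V n :=
  (1 / 2 : ℂ) • ∑ u, ∑ v, if G.Adj u v then
    ∑ i, siteOp u (spinMatrix n i) ∘ₗ siteOp v (spinMatrix n i) else 0

/-- The components `S_x, S_y, S_z` of the total spin. -/
def totalSpin (V : Type) [Fintype V] [DecidableEq V] (n : ℕ) (i : Fin 3) :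
    State V n →ₗ[ℂ] State V n :=
  ∑ u, siteOp u (spinMatrix n i)

/-- The square of the total spin, `S_x² + S_y² + S_z²`. -/
def totalSpinSq (V : Type) [Fintype V] [DecidableEq V] (n : ℕ) : State V n →ₗ[ℂ] State V n :=
  ∑ i, totalSpin V n i ∘ₗ totalSpin V n i

/-- The `a`-magnon space `H_a`: the eigenspace of `S_z` with eigenvalue `M = N s - a`. -/
def magnonSpace (V : Type) [Fintype V] [DecidableEq V] (n a : ℕ) : Submodule ℂ (State V n) :=
  Module.End.eigenspace (totalSpin V n 2) ((Fintype.card V : ℂ) * ((n : ℂ) / 2) - a)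

/-- The configuration in which the magnetic quantum number is `s - 1` at the sites of `A` and `s`
at the other sites. -/
def flipped (n : ℕ) (A : Finset V) : V → Fin (n + 1) := fun u => if u ∈ A then 1 else 0

/-- The product state `|n₁, …, n_a⟩` with lowered spins at the sites `A = {n₁, …, n_a}`. -/
def ket (n : ℕ) (A : Finset V) : State V n := Pi.single (flipped n A) 1

/-- The span of the isolated product states with `a` lowered sites, that is, of those whose
lowered sites are pairwise not neighbours. -/
def isolatedSpace (G : SimpleGraph V) (n a : ℕ) : Submodule ℂ (State V n) :=
  Submodule.span ℂ {Ψ | ∃ A : Finset V, A.card = a ∧ G.IsIndepSet (A : Set V) ∧ Ψ = ket n A}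

/-- The set of energy eigenvalues of the restriction `H_a` of the Hamiltonian to the `a`-magnon
space. -/
def magnonEnergies (G : SimpleGraph V) [DecidableRel G.Adj] (n a : ℕ) : Set ℝ :=
  {E | ∃ Ψ ∈ magnonSpace V n a, Module.End.HasEigenvector (hamiltonian G n) (E : ℂ) Ψ}

/-- The set of energy eigenvalues of the Hamiltonian for total spin quantum number `S`, that is,
on the eigenspace of the squared total spin with eigenvalue `S (S + 1)`. -/
def totalSpinEnergies (G : SimpleGraph V) [DecidableRel G.Adj] (n : ℕ) (S : ℝ) : Set ℝ :=
  {E | ∃ Ψ ∈ Module.End.eigenspace (totalSpinSq V n) ((S * (S + 1) : ℝ) : ℂ),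
    Module.End.HasEigenvector (hamiltonian G n) (E : ℂ) Ψ}

/-- `L` runs through the sites of a ring (a cycle of length `k`) of the graph. -/
def IsRing {V : Type} (G : SimpleGraph V) (k : ℕ) [NeZero k] (L : Fin k → V) : Prop :=
  Function.Injective L ∧ ∀ i, G.Adj (L i) (L (i + 1))

/-- `L` runs through an 8-loop: a ring of 8 sites which circumscribes two adjacent pentagons, i.e.
which consists of the sites of two pentagons except for their common site `c`. -/
def IsEightLoop {V : Type} (G : SimpleGraph V) (L : Fin 8 → V) : Prop :=
  IsRing G 8 L ∧ ∃ (c : V) (r : Fin 8),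
    IsRing G 5 ![c, L r, L (r + 1), L (r + 2), L (r + 3)] ∧
    IsRing G 5 ![c, L (r + 4), L (r + 5), L (r + 6), L (r + 7)]

/-- The distance of two loops is `d`: the minimal distance of their sites. -/
def LoopDistEq {V : Type} (G : SimpleGraph V) (L L' : Fin 8 → V) (d : ℕ) : Prop :=
  IsLeast {m : ℕ | ∃ i j, m = G.dist (L i) (L' j)} d

/-- The localized one-magnon state on a loop, with alternating amplitudes `±1`. -/
def oneLoopState (n : ℕ) (L : Fin 8 → V) : State V n :=
  ∑ i : Fin 8, ((-1 : ℂ) ^ i.val) • ket n {L i}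

/-- The two-magnon state `∑ ε_{n₁} δ_{n₂} |n₁, n₂⟩` on two loops, with alternating amplitudes `ε`
and `δ` along the first and the second loop. -/
def twoLoopState (n : ℕ) (L L' : Fin 8 → V) : State V n :=
  ∑ i : Fin 8, ∑ j : Fin 8, ((-1 : ℂ) ^ i.val * (-1 : ℂ) ^ j.val) • ket n {L i, L' j}

end Spin

/-! ### The icosidodecahedron

The sites are numbered `1, …, 30`; the site `30` is the element `30 = 0` of `Fin 30`. -/

section Icosidodecahedron

/-- Twice the golden ratio, `1 + √5`, as an element of `ℤ[√5]`. -/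
def τ : ℤ√5 := ⟨1, 1⟩

/-- The vertices of the icosidodecahedron, scaled so that its edges have length `4`: all cyclic
permutations of `(0, 0, ±4φ)` and of `(±2, ±2φ, ±2φ²)`, where `φ` is the golden ratio, `2φ = τ`
and `2φ² = τ + 2`. The list starts with the site `30`, which is followed by the sites
`1, …, 29`. -/
def position : Fin 30 → Fin 3 → ℤ√5 :=
  ![![-τ - 2, -2, -τ],
    ![0, 0, 2 * τ],
    ![2, τ, τ + 2],
    ![τ + 2, 2, τ],
    ![τ + 2, -2, τ],
    ![2, -τ, τ + 2],
    ![-2, τ, τ + 2],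
    ![τ, τ + 2, 2],
    ![2 * τ, 0, 0],
    ![τ, -τ - 2, 2],
    ![-2, -τ, τ + 2],
    ![-τ, τ + 2, 2],
    ![0, 2 * τ, 0],
    ![τ, τ + 2, -2],
    ![τ + 2, 2, -τ],
    ![τ + 2, -2, -τ],
    ![τ, -τ - 2, -2],
    ![0, -2 * τ, 0],
    ![-τ, -τ - 2, 2],
    ![-τ - 2, -2, τ],
    ![-τ - 2, 2, τ],
    ![-τ, τ + 2, -2],
    ![2, τ, -τ - 2],
    ![2, -τ, -τ - 2],
    ![-τ, -τ - 2, -2],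
    ![-2 * τ, 0, 0],
    ![-τ - 2, 2, -τ],
    ![-2, τ, -τ - 2],
    ![0, 0, -2 * τ],
    ![-2, -τ, -τ - 2]]

/-- The squared Euclidean distance of two vertices. -/
def sqDist (u v : Fin 30) : ℤ√5 :=
  (position u 0 - position v 0) * (position u 0 - position v 0) +
    (position u 1 - position v 1) * (position u 1 - position v 1) +
    (position u 2 - position v 2) * (position u 2 - position v 2)

/-- The coupling graph of the icosidodecahedron: neighbours are the vertices whose distance is the
edge length. -/
def icosidodecahedron : SimpleGraph (Fin 30) where
  Adj u v := sqDist u v = 16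
  symm := ⟨fun u v h => by rw [← h]; unfold sqDist; ring⟩
  loopless := ⟨fun u h => by
    have h0 : sqDist u u = 0 := by unfold sqDist; ring
    rw [h0] at h
    exact absurd h (by decide)⟩

instance : DecidableRel icosidodecahedron.Adj :=
  fun u v => inferInstanceAs (Decidable (sqDist u v = 16))

/-- The bonds in terms of the numbering: two pentagons `1, …, 5` and `26, …, 30`, the decagon
`11, …, 20`, and the sites `6, …, 10` and `21, …, 25` between them. -/
def bonds : List (Fin 30 × Fin 30) :=
  [(1, 2), (2, 3), (3, 4), (4, 5), (5, 1),
   (6, 1), (6, 2), (7, 2), (7, 3), (8, 3), (8, 4), (9, 4), (9, 5), (10, 5), (10, 1),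
   (6, 20), (6, 11), (7, 12), (7, 13), (8, 14), (8, 15), (9, 16), (9, 17), (10, 18), (10, 19),
   (11, 12), (12, 13), (13, 14), (14, 15), (15, 16), (16, 17), (17, 18), (18, 19), (19, 20),
   (20, 11),
   (21, 11), (21, 12), (22, 13), (22, 14), (23, 15), (23, 16), (24, 17), (24, 18), (25, 19),
   (25, 20),
   (21, 26), (21, 27), (22, 27), (22, 28), (23, 28), (23, 29), (24, 29), (24, 30), (25, 30),
   (25, 26),
   (26, 27), (27, 28), (28, 29), (29, 30), (30, 26)]

set_option maxRecDepth 100000 in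
theorem icosidodecahedron_adj_iff (u v : Fin 30) :
    icosidodecahedron.Adj u v ↔ (u, v) ∈ bonds ∨ (v, u) ∈ bonds := by
  revert u v
  decide +kernel

/-- The symmetry group of the icosidodecahedron (the icosahedral group with reflections), acting
on the vertices: the permutations of the vertices which preserve all distances. -/
def symmetryGroup : Subgroup (Equiv.Perm (Fin 30)) where
  carrier := {g | ∀ u v, sqDist (g u) (g v) = sqDist u v}
  mul_mem' {g h} hg hh u v := by
    rw [Equiv.Perm.mul_apply, Equiv.Perm.mul_apply, hg, hh]
  one_mem' _ _ := rfl
  inv_mem' {g} hg u v := by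
    have h := hg (g⁻¹ u) (g⁻¹ v)
    simpa using h.symm

/-- The orbit of a set of sites under the symmetry group. -/
def siteOrbit (T : Finset (Fin 30)) : Set (Finset (Fin 30)) :=
  {T' | ∃ g ∈ symmetryGroup, T' = T.image g}

/-- The table of the three-magnon state: representative triples, orbit lengths, amplitudes. -/
def table : List (Finset (Fin 30) × ℕ × ℤ) :=
  [({1, 3, 14}, 60, 1),
   ({1, 3, 15}, 120, -1),
   ({1, 3, 22}, 120, -1),
   ({1, 3, 23}, 120, 1),
   ({1, 3, 28}, 120, 1),
   ({1, 3, 29}, 60, -2),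
   ({1, 7, 15}, 120, 1),
   ({1, 7, 18}, 60, 1),
   ({1, 7, 23}, 120, -1),
   ({1, 7, 24}, 120, -1),
   ({1, 7, 29}, 60, 2),
   ({1, 8, 21}, 120, -1),
   ({1, 8, 25}, 30, 2),
   ({1, 8, 26}, 120, -1),
   ({1, 8, 27}, 120, 2),
   ({1, 8, 28}, 30, -2),
   ({1, 13, 16}, 20, -2),
   ({1, 13, 24}, 60, -1),
   ({1, 13, 30}, 60, 2),
   ({1, 14, 30}, 20, -1)]

open Classical in
/-- The amplitude of a triple of sites: the amplitude of the row of the table in whose orbit the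
triple lies, and `0` if there is no such row. (No triple lies in the orbits of two rows.) -/
def tableAmplitude (T : Finset (Fin 30)) : ℤ :=
  (table.map fun row => if T ∈ siteOrbit row.1 then row.2.2 else 0).sum

/-- The three-magnon state defined by the table. -/
def tableState (n : ℕ) : State (Fin 30) n :=
  ∑ T ∈ Finset.powersetCard 3 Finset.univ, (tableAmplitude T : ℂ) • ket n T

/-- Two 8-loops with distance 2. -/
def loop₁ : Fin 8 → Fin 30 := ![1, 2, 3, 4, 9, 17, 18, 10]

/-- See `loop₁`. -/
def loop₂ : Fin 8 → Fin 30 := ![12, 13, 22, 28, 29, 30, 26, 21]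

end Icosidodecahedron

end

end HighSpin

open HighSpin

/-! The bonds of the icosidodecahedron split into 20 triangles: every bond lies in exactly one,
every site in exactly two. Hence `H` is half the sum over the triangles of `S_t² - 3s(s+1)`, where
`S_t` is the total spin of the triangle `t`. Write `S_t² = S_t⁻S_t⁺ + (S_t^z)² + S_t^z` and let
`k_t` be the total deviation `∑ (s - m)` in `t`, so that `S_t^z = 3s - k_t`. With `a` magnons `∑ k_t
= 2a`, and therefore `H = 60s² - 6sa + (1/2) ∑ S_t⁻S_t⁺ + (1/2) ∑ (k_t² - k_t)`. Both sums are
nonnegative, the second because the `k_t` are natural numbers. This gives the lower bound `60s² -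
6sa` for every `s` and `a` (`IsTriangleCover.energy_ge`). An isolated state has all `k_t ≤ 1`, so it
attains the bound as soon as every `S_t⁺` annihilates it
(`IsTriangleCover.hamiltonian_of_raising_eq_zero`).

It remains to solve `S_t⁺Ψ = 0` on isolated states. For loops, every triangle meets an 8-loop in
disjoint pairs of consecutive sites, so alternating amplitudes cancel (`IsEightLoop.sum_eq_zero`);
distance 2 makes the product state of two loops isolated. For three magnons the condition is one
linear equation for each pair of sites and each triangle. Symmetry leaves eight pairs, and the
equations are checked by computation (`orbitAmplitude_sum_eq_zero`).

On one magnon `H` is a constant plus `s` times the adjacency matrix `A`, and `A + 2 = BᴴB` for the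
triangle-site incidence matrix `B`. The ground space is thus `ker B`, of dimension `30 - 20`, since
`B` is surjective (`incidence_triangle_surjective`).

For total spin, a joint eigenspace of `S²` and `H` with `S = Ns - a` contains a highest-weight
vector, which has `a` magnons. Conversely, an `a`-magnon eigenstate with an energy below the bound
for `a - 1` magnons is annihilated by `S⁺`, hence has this total spin. -/

namespace HighSpin

set_option linter.unusedSectionVars false
set_option maxRecDepth 100000

section SpinAlgebra

variable {V : Type} [Fintype V] [DecidableEq V] {n : ℕ}

/-! ### Spin matrices -/

theorem lowering_apply (n : ℕ) (i k : Fin (n + 1)) : lowering n i k =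
    if i.val = k.val + 1 then ((Real.sqrt (((n : ℝ) - k.val) * (k.val + 1)) : ℝ) : ℂ) else 0 :=
  rfl

theorem raising_apply (n : ℕ) (i k : Fin (n + 1)) : raising n i k =
    if k.val = i.val + 1 then ((Real.sqrt (((n : ℝ) - i.val) * (i.val + 1)) : ℝ) : ℂ) else 0 := by
  rw [raising, Matrix.conjTranspose_apply, lowering_apply]
  split_ifs <;> simp

theorem spinMatrix_two (n : ℕ) :
    spinMatrix n 2 = Matrix.diagonal fun k : Fin (n + 1) => (n : ℂ) / 2 - k.val := rfl

theorem conjTranspose_raising (n : ℕ) : (raising n).conjTranspose = lowering n :=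
  Matrix.conjTranspose_conjTranspose _

theorem sqrt_mul_sqrt_ladder {n k : ℕ} (h : k ≤ n) :
    ((Real.sqrt (((n : ℝ) - k) * (k + 1)) : ℝ) : ℂ) *
      ((Real.sqrt (((n : ℝ) - k) * (k + 1)) : ℝ) : ℂ) = ((n : ℂ) - k) * (k + 1) := by
  have h' : (k : ℝ) ≤ n := by exact_mod_cast h
  rw [← Complex.ofReal_mul, Real.mul_self_sqrt (mul_nonneg (by linarith) (by positivity))]
  push_cast
  ring

theorem lowering_mul_raising (n : ℕ) : lowering n * raising n =
    Matrix.diagonal fun k : Fin (n + 1) => (k.val : ℂ) * (n - k.val + 1) := by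
  ext i j
  rw [Matrix.mul_apply]
  simp only [lowering_apply, raising_apply, Matrix.diagonal_apply]
  refine Fin.cases ?_ (fun i => ?_) i
  · simp
  · rw [Finset.sum_eq_single i.castSucc]
    · rcases eq_or_ne i.succ j with rfl | h
      · simp only [Fin.val_succ, Fin.val_castSucc, if_true]
        rw [sqrt_mul_sqrt_ladder i.is_lt.le]
        push_cast
        ring
      · have hj : ¬ j.val = i.castSucc.val + 1 := fun hj => h (Fin.ext (by simpa using hj.symm))
        rw [if_neg h, if_neg hj, mul_zero]
    · intro k _ hk
      rw [if_neg, zero_mul]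
      intro h
      exact hk (Fin.ext (by simpa using h.symm))
    · simp

theorem raising_mul_lowering (n : ℕ) : raising n * lowering n =
    Matrix.diagonal fun k : Fin (n + 1) => ((n : ℂ) - k.val) * (k.val + 1) := by
  ext i j
  rw [Matrix.mul_apply]
  simp only [lowering_apply, raising_apply, Matrix.diagonal_apply]
  refine Fin.lastCases ?_ (fun i => ?_) i
  -- The last row of `s⁺` is zero, which agrees with the factor `n - k` at `k = n`.
  · rw [Finset.sum_eq_zero]
    · simp
    · intro k _
      rw [if_neg, zero_mul]
      have := k.is_lt
      simp only [Fin.val_last]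
      omega
  · rw [Finset.sum_eq_single i.succ]
    · rcases eq_or_ne i.castSucc j with rfl | h
      · simp only [Fin.val_succ, Fin.val_castSucc, if_true]
        exact sqrt_mul_sqrt_ladder i.is_lt.le
      · have hj : ¬ i.succ.val = j.val + 1 := fun hj => h (Fin.ext (by simpa using hj))
        rw [if_neg h, if_neg hj, mul_zero]
    · intro k _ hk
      rw [if_neg, zero_mul]
      intro h
      exact hk (Fin.ext (by simpa using h))
    · simp

theorem raising_lowering_commutator (n : ℕ) :
    raising n * lowering n - lowering n * raising n = (2 : ℂ) • spinMatrix n 2 := by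
  rw [raising_mul_lowering, lowering_mul_raising, spinMatrix_two, Matrix.diagonal_sub,
    ← Matrix.diagonal_smul]
  congr 1
  funext k
  simp only [Pi.smul_apply, smul_eq_mul]
  ring

theorem z_raising_commutator (n : ℕ) :
    spinMatrix n 2 * raising n - raising n * spinMatrix n 2 = raising n := by
  ext i j
  rw [spinMatrix_two, Matrix.sub_apply, Matrix.diagonal_mul, Matrix.mul_diagonal, raising_apply]
  split_ifs with h
  · rw [h]
    push_cast
    ring
  · simp

theorem casimir_spinMatrix (n : ℕ) : lowering n * raising n + spinMatrix n 2 * spinMatrix n 2 +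
    spinMatrix n 2 = ((n : ℂ) / 2 * ((n : ℂ) / 2 + 1)) • (1 : Matrix _ _ ℂ) := by
  rw [lowering_mul_raising, spinMatrix_two, Matrix.diagonal_mul_diagonal, Matrix.diagonal_add,
    Matrix.diagonal_add, ← Matrix.diagonal_one, ← Matrix.diagonal_smul]
  congr 1
  funext k
  simp only [Pi.smul_apply, smul_eq_mul]
  ring

/-! ### Operators on a single site -/

theorem siteOp_apply (u : V) (A : Matrix (Fin (n + 1)) (Fin (n + 1)) ℂ) (Ψ : State V n)
    (σ : V → Fin (n + 1)) :
    siteOp u A Ψ σ = ∑ k, A (σ u) k * Ψ (Function.update σ u k) := rfl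

/-- The action of the one-site operators at the site `u`, as a homomorphism of algebras. -/
noncomputable def siteHom (n : ℕ) (u : V) :
    Matrix (Fin (n + 1)) (Fin (n + 1)) ℂ →ₐ[ℂ] Module.End ℂ (State V n) :=
  AlgHom.ofLinearMap
    { toFun := siteOp u
      map_add' := fun A B => by
        refine LinearMap.ext fun Ψ => funext fun σ => ?_
        simp [siteOp_apply, add_mul, Finset.sum_add_distrib]
      map_smul' := fun c A => by
        refine LinearMap.ext fun Ψ => funext fun σ => ?_
        simp [siteOp_apply, Finset.mul_sum, mul_assoc] }
    (by
      refine LinearMap.ext fun Ψ => funext fun σ => ?_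
      simp [siteOp_apply, Matrix.one_apply])
    (fun A B => by
      refine LinearMap.ext fun Ψ => funext fun σ => ?_
      simp only [LinearMap.coe_mk, AddHom.coe_mk, Module.End.mul_apply, siteOp_apply,
        Matrix.mul_apply, Finset.sum_mul, Finset.mul_sum, Function.update_self,
        Function.update_idem]
      rw [Finset.sum_comm]
      exact Finset.sum_congr rfl fun _ _ => Finset.sum_congr rfl fun _ _ => by ring)

theorem siteHom_apply (u : V) (A : Matrix (Fin (n + 1)) (Fin (n + 1)) ℂ) :
    siteHom n u A = siteOp u A := rfl

theorem siteHom_commute {u v : V} (h : u ≠ v) (A B : Matrix (Fin (n + 1)) (Fin (n + 1)) ℂ) :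
    Commute (siteHom n u A) (siteHom n v B) := by
  refine LinearMap.ext fun Ψ => funext fun σ => ?_
  simp only [Module.End.mul_apply, siteHom_apply, siteOp_apply, Finset.mul_sum,
    Function.update_of_ne h, Function.update_of_ne h.symm]
  rw [Finset.sum_comm]
  refine Finset.sum_congr rfl fun k _ => Finset.sum_congr rfl fun l _ => ?_
  rw [Function.update_comm h]
  ring

theorem siteHom_single (u : V) (A : Matrix (Fin (n + 1)) (Fin (n + 1)) ℂ)
    (τ : V → Fin (n + 1)) : siteHom n u A (Pi.single τ 1 : State V n) =
      ∑ i, A i (τ u) • (Pi.single (Function.update τ u i) 1 : State V n) := by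
  funext σ
  rw [siteHom_apply, siteOp_apply, Finset.sum_apply]
  simp only [Pi.smul_apply, Pi.single_apply, smul_eq_mul, mul_ite, mul_one, mul_zero]
  -- The condition says that `σ` and `τ` agree away from `u`. In that case each of the two sums has
  -- a single nonzero term at most, with the same value; otherwise both are zero.
  by_cases h : σ = Function.update τ u (σ u)
  · have h1 : ∀ k, Function.update σ u k = τ ↔ k = τ u := by
      intro k
      constructor
      · rintro rfl
        simp
      · rintro rfl
        rw [h, Function.update_idem, Function.update_eq_self]
    have h2 : ∀ k, σ = Function.update τ u k ↔ k = σ u := by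
      intro k
      constructor
      · rintro h3
        rw [h3]
        simp
      · rintro rfl
        exact h
    simp [h1, h2]
  · have h1 : ∀ k, Function.update σ u k ≠ τ := by
      rintro k rfl
      exact h (by simp)
    have h2 : ∀ k, σ ≠ Function.update τ u k := by
      intro k h3
      apply h
      nth_rewrite 2 [h3]
      simpa using h3
    simp [h1, h2]

theorem star_siteHom_dotProduct (u : V) (A : Matrix (Fin (n + 1)) (Fin (n + 1)) ℂ)
    (Φ Ψ : State V n) :
    star (siteHom n u A Φ) ⬝ᵥ Ψ = star Φ ⬝ᵥ siteHom n u A.conjTranspose Ψ := by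
  simp only [dotProduct, siteHom_apply, Pi.star_apply, siteOp_apply, star_sum, star_mul',
    Finset.sum_mul, Finset.mul_sum, Matrix.conjTranspose_apply]
  rw [← Fintype.sum_prod_type' fun (σ : V → Fin (n + 1)) (k : Fin (n + 1)) =>
      star (A (σ u) k) * star (Φ (Function.update σ u k)) * Ψ σ,
    ← Fintype.sum_prod_type' fun (σ : V → Fin (n + 1)) (k : Fin (n + 1)) =>
      star (Φ σ) * (star (A k (σ u)) * Ψ (Function.update σ u k))]
  -- The involution exchanges the value of `σ` at `u` with the summation index `k`.
  refine Finset.sum_nbij' (fun p => (Function.update p.1 u p.2, p.1 u))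
    (fun p => (Function.update p.1 u p.2, p.1 u)) ?_ ?_ ?_ ?_ ?_
  · simp
  · simp
  · rintro ⟨σ, k⟩ -
    simp
  · rintro ⟨σ, k⟩ -
    simp
  · rintro ⟨σ, k⟩ -
    simp only [Function.update_self, Function.update_idem, Function.update_eq_self]
    ring

/-! ### Spins of sets of sites -/

/-- The sum of the one-site operators `A` over the sites of `t`. -/
noncomputable def spinSum (t : Finset V) (A : Matrix (Fin (n + 1)) (Fin (n + 1)) ℂ) :
    Module.End ℂ (State V n) :=
  ∑ u ∈ t, siteHom n u A

/-- The squared total spin of the sites of `t`. -/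
noncomputable def casimir (n : ℕ) (t : Finset V) : Module.End ℂ (State V n) :=
  ∑ i, spinSum t (spinMatrix n i) * spinSum t (spinMatrix n i)

theorem spinSum_add (t : Finset V) (A B : Matrix (Fin (n + 1)) (Fin (n + 1)) ℂ) :
    spinSum t (A + B) = spinSum t A + spinSum t B := by
  simp [spinSum, Finset.sum_add_distrib]

theorem spinSum_sub (t : Finset V) (A B : Matrix (Fin (n + 1)) (Fin (n + 1)) ℂ) :
    spinSum t (A - B) = spinSum t A - spinSum t B := by
  simp [spinSum, Finset.sum_sub_distrib]

theorem spinSum_smul (t : Finset V) (c : ℂ) (A : Matrix (Fin (n + 1)) (Fin (n + 1)) ℂ) :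
    spinSum t (c • A) = c • spinSum t A := by
  simp [spinSum, Finset.smul_sum]

theorem spinSum_disjoint_commute {t t' : Finset V} (h : Disjoint t t')
    (A B : Matrix (Fin (n + 1)) (Fin (n + 1)) ℂ) : Commute (spinSum t A) (spinSum t' B) :=
  Commute.sum_left _ _ _ fun _ hu => Commute.sum_right _ _ _ fun _ hv =>
    siteHom_commute (Finset.disjoint_iff_ne.mp h _ hu _ hv) A B

/-- Operators at different sites commute, so only the diagonal terms of the double sum survive. All
commutation relations of collective spins follow from those of a single spin in this way. -/
theorem spinSum_commutator (t : Finset V) (A B : Matrix (Fin (n + 1)) (Fin (n + 1)) ℂ) :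
    spinSum t A * spinSum t B - spinSum t B * spinSum t A = spinSum t (A * B - B * A) := by
  simp only [spinSum, Finset.sum_mul_sum]
  rw [Finset.sum_comm (f := fun u v => siteHom n u B * siteHom n v A), ← Finset.sum_sub_distrib]
  refine Finset.sum_congr rfl fun u hu => ?_
  rw [← Finset.sum_sub_distrib, Finset.sum_eq_single u]
  · simp
  · intro v _ hv
    rw [(siteHom_commute hv.symm A B).eq, sub_self]
  · exact fun h => absurd hu h

theorem spinSum_raising_lowering (t : Finset V) :
    spinSum t (raising n) * spinSum t (lowering n) =
      spinSum t (lowering n) * spinSum t (raising n) + (2 : ℂ) • spinSum t (spinMatrix n 2) := by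
  rw [← spinSum_smul, ← raising_lowering_commutator, ← spinSum_commutator]
  abel

theorem spinSum_z_raising (t : Finset V) :
    spinSum t (spinMatrix n 2) * spinSum t (raising n) =
      spinSum t (raising n) * spinSum t (spinMatrix n 2) + spinSum t (raising n) := by
  nth_rewrite 3 [← z_raising_commutator]
  rw [← spinSum_commutator]
  abel

theorem z_lowering_commutator (n : ℕ) :
    lowering n * spinMatrix n 2 - spinMatrix n 2 * lowering n = lowering n := by
  ext i j
  rw [spinMatrix_two, Matrix.sub_apply, Matrix.diagonal_mul, Matrix.mul_diagonal, lowering_apply]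
  split_ifs with h
  · rw [h]
    push_cast
    ring
  · simp

theorem spinSum_z_lowering (t : Finset V) :
    spinSum t (spinMatrix n 2) * spinSum t (lowering n) =
      spinSum t (lowering n) * spinSum t (spinMatrix n 2) - spinSum t (lowering n) := by
  nth_rewrite 3 [← z_lowering_commutator]
  rw [← spinSum_commutator]
  abel

/-- With `S⁺` on the right, the first term vanishes on states annihilated by `S⁺` and has
nonnegative expectation values on all states; the other terms are diagonal in the product basis. -/
theorem casimir_eq (t : Finset V) : casimir n t =
    spinSum t (lowering n) * spinSum t (raising n) +
      spinSum t (spinMatrix n 2) * spinSum t (spinMatrix n 2) + spinSum t (spinMatrix n 2) := by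
  have h0 : spinMatrix n 0 = (1 / 2 : ℂ) • (raising n + lowering n) := rfl
  have h1 : spinMatrix n 1 = (1 / (2 * Complex.I) : ℂ) • (raising n - lowering n) := rfl
  have hI : (1 / (2 * Complex.I) : ℂ) * (1 / (2 * Complex.I)) = -(1 / 4) := by
    rw [div_mul_div_comm, mul_mul_mul_comm, Complex.I_mul_I]
    norm_num
  rw [casimir, Fin.sum_univ_three, h0, h1, spinSum_smul, spinSum_smul, smul_mul_smul_comm,
    smul_mul_smul_comm, hI, spinSum_add, spinSum_sub]
  have h := spinSum_raising_lowering (n := n) t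
  simp only [add_mul, mul_add, sub_mul, mul_sub, h]
  module

theorem casimir_commute_z (t : Finset V) :
    Commute (casimir n t) (spinSum t (spinMatrix n 2)) := by
  have h1 := spinSum_z_raising (n := n) t
  have h2 := spinSum_z_lowering (n := n) t
  rw [casimir_eq]
  refine Commute.add_left (Commute.add_left ?_ ?_) (Commute.refl _)
  · rw [commute_iff_eq, ← mul_assoc, h2, mul_assoc, sub_mul, mul_assoc, h1, mul_add]
    abel
  · exact (Commute.refl _).mul_left (Commute.refl _)

theorem casimir_commute_raising (t : Finset V) :
    Commute (casimir n t) (spinSum t (raising n)) := by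
  have h1 := spinSum_z_raising (n := n) t
  have h3 := spinSum_raising_lowering (n := n) t
  rw [casimir_eq, commute_iff_eq]
  simp only [add_mul, mul_add, mul_assoc, h1]
  simp only [← mul_assoc, h1, h3, add_mul, smul_mul_assoc]
  module

theorem star_spinSum_dotProduct (t : Finset V) (A : Matrix (Fin (n + 1)) (Fin (n + 1)) ℂ)
    (Φ Ψ : State V n) :
    star (spinSum t A Φ) ⬝ᵥ Ψ = star Φ ⬝ᵥ spinSum t A.conjTranspose Ψ := by
  simp only [spinSum, LinearMap.sum_apply, star_sum, sum_dotProduct, dotProduct_sum,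
    star_siteHom_dotProduct]

theorem siteHom_z_apply (u : V) (Ψ : State V n) (σ : V → Fin (n + 1)) :
    siteHom n u (spinMatrix n 2) Ψ σ = ((n : ℂ) / 2 - (σ u).val) * Ψ σ := by
  simp [siteHom_apply, siteOp_apply, spinMatrix_two, Matrix.diagonal_apply]

theorem spinSum_z_apply (t : Finset V) (Ψ : State V n) (σ : V → Fin (n + 1)) :
    spinSum t (spinMatrix n 2) Ψ σ =
      ((t.card : ℂ) * ((n : ℂ) / 2) - (∑ u ∈ t, (σ u).val : ℕ)) * Ψ σ := by
  simp only [spinSum, LinearMap.sum_apply, Finset.sum_apply, siteHom_z_apply, ← Finset.sum_mul,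
    Finset.sum_sub_distrib, Finset.sum_const, nsmul_eq_mul, Nat.cast_sum]

theorem totalSpin_eq (i : Fin 3) :
    totalSpin V n i = spinSum Finset.univ (spinMatrix n i) := rfl

theorem totalSpinSq_eq : totalSpinSq V n = casimir n Finset.univ := rfl

/-- `S_z` is diagonal with entries `Ns - ∑ σ u`, so being an eigenvector is a condition on the
support. -/
theorem mem_magnonSpace_iff {a : ℕ} {Ψ : State V n} :
    Ψ ∈ magnonSpace V n a ↔ ∀ σ, Ψ σ ≠ 0 → ∑ u, (σ u).val = a := by
  rw [magnonSpace, Module.End.mem_eigenspace_iff, totalSpin_eq, funext_iff]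
  refine forall_congr' fun σ => ?_
  rw [spinSum_z_apply, Pi.smul_apply, smul_eq_mul, mul_eq_mul_right_iff, Finset.card_univ,
    sub_right_inj, Nat.cast_inj, or_iff_not_imp_right]

end SpinAlgebra

section Kets

variable {V : Type} [Fintype V] [DecidableEq V] {n : ℕ}

/-! ### Product states with single spin flips -/

/-- For `n = 0` the numeral `1 : Fin 1` is `0` and a flipped spin would not differ from an unflipped
one. This is the source of the hypothesis `1 ≤ n` throughout. -/
theorem fin_val_one_of_le (hn : 1 ≤ n) : (1 : Fin (n + 1)).val = 1 := by
  obtain ⟨m, rfl⟩ := Nat.exists_eq_add_of_le' hn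
  rfl

theorem flipped_val (hn : 1 ≤ n) (A : Finset V) (u : V) :
    (flipped n A u).val = if u ∈ A then 1 else 0 := by
  rw [flipped]
  split_ifs
  · exact fin_val_one_of_le hn
  · rfl

theorem sum_flipped_val (hn : 1 ≤ n) (A t : Finset V) :
    ∑ u ∈ t, (flipped n A u).val = (t ∩ A).card := by
  simp [flipped_val hn, Finset.sum_ite_mem]

theorem flipped_injective (hn : 1 ≤ n) :
    Function.Injective (flipped n : Finset V → V → Fin (n + 1)) := by
  intro A B h
  ext u
  have h' := congrArg Fin.val (congrFun h u)
  rw [flipped_val hn, flipped_val hn] at h'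
  split_ifs at h' <;> simp_all

theorem ket_apply_flipped (hn : 1 ≤ n) (A B : Finset V) :
    ket n A (flipped n B) = if B = A then 1 else 0 := by
  rw [ket, Pi.single_apply]
  exact if_congr (flipped_injective hn).eq_iff rfl rfl

theorem ket_mem_magnonSpace (hn : 1 ≤ n) (A : Finset V) : ket n A ∈ magnonSpace V n A.card := by
  rw [mem_magnonSpace_iff]
  intro σ hσ
  have h : σ = flipped n A := by
    by_contra h
    exact hσ (Pi.single_eq_of_ne h _)
  rw [h, sum_flipped_val hn, Finset.univ_inter]

theorem flipped_erase (A : Finset V) (u : V) :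
    flipped n (A.erase u) = Function.update (flipped n A) u 0 := by
  funext v
  rcases eq_or_ne v u with rfl | h
  · simp [flipped]
  · simp [flipped, h]

theorem flipped_singleton (u : V) :
    flipped n {u} = Function.update (flipped n (∅ : Finset V)) u 1 := by
  funext v
  rcases eq_or_ne v u with rfl | h
  · simp [flipped]
  · simp [flipped, h]

theorem raising_apply_zero (i : Fin (n + 1)) : raising n i 0 = 0 := by
  simp [raising_apply]

theorem raising_apply_one (hn : 1 ≤ n) (i : Fin (n + 1)) :
    raising n i 1 = if i = 0 then ((Real.sqrt n : ℝ) : ℂ) else 0 := by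
  have h1 := fin_val_one_of_le hn
  have h2 : (1 : Fin (n + 1)).val = i.val + 1 ↔ i = 0 := by
    rw [h1, Fin.ext_iff, Fin.val_zero]
    omega
  rw [raising_apply]
  simp only [h2]
  split_ifs with h
  · simp [h]
  · rfl

theorem lowering_apply_zero (hn : 1 ≤ n) (i : Fin (n + 1)) :
    lowering n i 0 = if i = 1 then ((Real.sqrt n : ℝ) : ℂ) else 0 := by
  have h1 := fin_val_one_of_le hn
  have h2 : i.val = (0 : Fin (n + 1)).val + 1 ↔ i = 1 := by
    rw [Fin.ext_iff, h1, Fin.val_zero]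
  rw [lowering_apply]
  simp only [h2]
  split_ifs with h
  · simp
  · rfl

theorem siteHom_raising_ket (hn : 1 ≤ n) (u : V) (A : Finset V) :
    siteHom n u (raising n) (ket n A) =
      if u ∈ A then ((Real.sqrt n : ℝ) : ℂ) • ket n (A.erase u) else 0 := by
  rw [ket, siteHom_single]
  split_ifs with h
  · have hu : flipped n A u = 1 := if_pos h
    simp only [hu, raising_apply_one hn, ite_smul, zero_smul, Finset.sum_ite_eq', Finset.mem_univ,
      if_true]
    rw [ket, flipped_erase]
  · have hu : flipped n A u = 0 := if_neg h
    simp [hu, raising_apply_zero]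

theorem spinSum_raising_ket (hn : 1 ≤ n) (t A : Finset V) :
    spinSum t (raising n) (ket n A) =
      ((Real.sqrt n : ℝ) : ℂ) • ∑ u ∈ t, if u ∈ A then ket n (A.erase u) else 0 := by
  simp only [spinSum, LinearMap.sum_apply, siteHom_raising_ket hn, Finset.smul_sum, smul_ite,
    smul_zero]

theorem spinSum_lowering_ket_empty (hn : 1 ≤ n) (t : Finset V) :
    spinSum t (lowering n) (ket n ∅) =
      ((Real.sqrt n : ℝ) : ℂ) • ∑ u ∈ t, ket n {u} := by
  simp only [spinSum, LinearMap.sum_apply, Finset.smul_sum]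
  refine Finset.sum_congr rfl fun u _ => ?_
  have hu : flipped n (∅ : Finset V) u = 0 := by simp [flipped]
  rw [ket, siteHom_single]
  simp only [hu, lowering_apply_zero hn, ite_smul, zero_smul, Finset.sum_ite_eq', Finset.mem_univ,
      if_true]
  rw [ket, flipped_singleton]

theorem exists_of_mem_isolatedSpace {G : SimpleGraph V} {a : ℕ} {Ψ : State V n}
    (h : Ψ ∈ isolatedSpace G n a) {σ : V → Fin (n + 1)} (hσ : Ψ σ ≠ 0) :
    ∃ A : Finset V, A.card = a ∧ G.IsIndepSet (A : Set V) ∧ σ = flipped n A := by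
  by_contra hc
  refine hσ (Submodule.span_induction (p := fun Φ _ => Φ σ = 0) ?_ rfl ?_ ?_ h)
  · rintro _ ⟨A, hA, hG, rfl⟩
    exact Pi.single_eq_of_ne (fun h' => hc ⟨A, hA, hG, h'⟩) _
  · intro Φ Φ' _ _ h1 h2
    rw [Pi.add_apply, h1, h2, add_zero]
  · intro c Φ _ h1
    rw [Pi.smul_apply, h1, smul_zero]

theorem isolatedSpace_le_magnonSpace (hn : 1 ≤ n) (G : SimpleGraph V) (a : ℕ) :
    isolatedSpace G n a ≤ magnonSpace V n a := by
  rw [isolatedSpace, Submodule.span_le]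
  rintro _ ⟨A, rfl, -, rfl⟩
  exact ket_mem_magnonSpace hn A

end Kets

/-! ### Graphs whose bonds are covered by triangles -/

section TriangleCover

variable {V : Type} [Fintype V] [DecidableEq V] {n : ℕ} {ι : Type} [Fintype ι]

/-- The sets `τ t` are triangles of the graph, such that each bond lies in exactly one of them and
each site in exactly two. -/
structure IsTriangleCover (G : SimpleGraph V) [DecidableRel G.Adj] (τ : ι → Finset V) : Prop where
  card_eq : ∀ t, (τ t).card = 3
  card_site : ∀ u, (Finset.univ.filter fun t => u ∈ τ t).card = 2
  card_bond : ∀ u v, u ≠ v →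
    (Finset.univ.filter fun t => u ∈ τ t ∧ v ∈ τ t).card = if G.Adj u v then 1 else 0

variable {G : SimpleGraph V} [DecidableRel G.Adj] {τ : ι → Finset V}

theorem IsTriangleCover.adj (h : IsTriangleCover G τ) {u v : V} (huv : u ≠ v) {t : ι}
    (hu : u ∈ τ t) (hv : v ∈ τ t) : G.Adj u v := by
  by_contra hc
  have h1 := h.card_bond u v huv
  rw [if_neg hc, Finset.card_eq_zero] at h1
  exact Finset.eq_empty_iff_forall_notMem.mp h1 t (by simp [hu, hv])

theorem IsTriangleCover.exists_of_adj (h : IsTriangleCover G τ) {u v : V} (huv : G.Adj u v) :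
    ∃ t, u ∈ τ t ∧ v ∈ τ t := by
  have h1 := h.card_bond u v huv.ne
  rw [if_pos huv, Finset.card_eq_one] at h1
  obtain ⟨t, ht⟩ := h1
  have h2 : t ∈ Finset.univ.filter fun t => u ∈ τ t ∧ v ∈ τ t := ht ▸ Finset.mem_singleton_self t
  exact ⟨t, (Finset.mem_filter.mp h2).2⟩

theorem IsTriangleCover.sum_sum (h : IsTriangleCover G τ) {M : Type*} [AddCommMonoid M]
    (f : V → M) : ∑ t, ∑ u ∈ τ t, f u = 2 • ∑ u, f u := by
  have h1 : ∀ t, ∑ u ∈ τ t, f u = ∑ u, if u ∈ τ t then f u else 0 := fun t => by simp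
  simp only [h1]
  rw [Finset.sum_comm, Finset.smul_sum]
  refine Finset.sum_congr rfl fun u _ => ?_
  rw [← Finset.sum_filter, Finset.sum_const, h.card_site]

/-- Double counting: an ordered pair of distinct sites occurs in one triangle if it is a bond, and
in none otherwise. -/
theorem IsTriangleCover.sum_offDiag (h : IsTriangleCover G τ) {M : Type*} [AddCommMonoid M]
    (f : V → V → M) : ∑ t, ∑ u ∈ τ t, ∑ v ∈ (τ t).erase u, f u v =
      ∑ u, ∑ v, if G.Adj u v then f u v else 0 := by
  have h1 : ∀ t, ∑ u ∈ τ t, ∑ v ∈ (τ t).erase u, f u v =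
      ∑ u, ∑ v, if u ≠ v ∧ u ∈ τ t ∧ v ∈ τ t then f u v else 0 := by
    intro t
    rw [← Finset.sum_filter_add_sum_filter_not Finset.univ (fun u => u ∈ τ t)]
    rw [Finset.sum_eq_zero (s := Finset.univ.filter fun u => ¬ u ∈ τ t), add_zero,
      Finset.filter_univ_mem]
    · refine Finset.sum_congr rfl fun u hu => ?_
      rw [← Finset.sum_filter]
      refine Finset.sum_congr ?_ fun _ _ => rfl
      ext v
      simp [hu, eq_comm]
    · intro u hu
      exact Finset.sum_eq_zero fun v _ => if_neg fun h' => (Finset.mem_filter.mp hu).2 h'.2.1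
  simp only [h1]
  rw [Finset.sum_comm]
  refine Finset.sum_congr rfl fun u _ => ?_
  rw [Finset.sum_comm]
  refine Finset.sum_congr rfl fun v _ => ?_
  rcases eq_or_ne u v with rfl | huv
  · simp
  · simp only [huv, ne_eq, not_false_eq_true, true_and]
    rw [← Finset.sum_filter, Finset.sum_const, h.card_bond u v huv]
    split_ifs <;> simp

theorem casimir_eq_sum_offDiag (t : Finset V) : casimir n t =
    ((t.card : ℂ) * ((n : ℂ) / 2 * ((n : ℂ) / 2 + 1))) • 1 +
      ∑ u ∈ t, ∑ v ∈ t.erase u,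
        ∑ i, siteOp u (spinMatrix n i) ∘ₗ siteOp v (spinMatrix n i) := by
  -- The diagonal terms are the one-site Casimirs `s(s+1)`, read off from `casimir_eq` for a
  -- singleton.
  have h0 : ∀ u, ∑ i, siteHom n u (spinMatrix n i) * siteHom n u (spinMatrix n i) =
      ((n : ℂ) / 2 * ((n : ℂ) / 2 + 1)) • (1 : Module.End ℂ (State V n)) := by
    intro u
    have h1 := casimir_eq (n := n) {u}
    simp only [casimir, spinSum, Finset.sum_singleton] at h1
    rw [h1, ← map_mul, ← map_mul, ← map_add, ← map_add, casimir_spinMatrix, map_smul, map_one]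
  have h2 : ∀ u ∈ t, ∑ v ∈ t, ∑ i, siteHom n u (spinMatrix n i) * siteHom n v (spinMatrix n i) =
      ((n : ℂ) / 2 * ((n : ℂ) / 2 + 1)) • (1 : Module.End ℂ (State V n)) + ∑ v ∈ t.erase u,
        ∑ i, siteHom n u (spinMatrix n i) * siteHom n v (spinMatrix n i) := by
    intro u hu
    rw [← Finset.add_sum_erase _ _ hu, h0]
  simp only [casimir, spinSum, Finset.sum_mul_sum]
  rw [Finset.sum_comm]
  have h3 : ∀ u, ∑ i, ∑ v ∈ t, siteHom n u (spinMatrix n i) * siteHom n v (spinMatrix n i) =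
      ∑ v ∈ t, ∑ i, siteHom n u (spinMatrix n i) * siteHom n v (spinMatrix n i) :=
    fun u => Finset.sum_comm
  simp only [h3]
  rw [Finset.sum_congr rfl h2, Finset.sum_add_distrib, Finset.sum_const,
    ← Nat.cast_smul_eq_nsmul ℂ, smul_smul]
  rfl

theorem IsTriangleCover.hamiltonian_eq (h : IsTriangleCover G τ) (n : ℕ) :
    hamiltonian G n = (1 / 2 : ℂ) •
      ∑ t, (casimir n (τ t) - (3 * ((n : ℂ) / 2 * ((n : ℂ) / 2 + 1))) • 1) := by
  rw [hamiltonian, ← h.sum_offDiag]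
  congr 1
  refine Finset.sum_congr rfl fun t _ => ?_
  rw [casimir_eq_sum_offDiag, h.card_eq]
  simp

/-- For a triangle with deviation `k` one has `(3s-k)² + (3s-k) - 3s(s+1) = 6s² - 6sk + k² - k`.
Summing over the triangles turns `∑ k` into `2a`, because each site is counted twice. -/
theorem IsTriangleCover.hamiltonian_apply (h : IsTriangleCover G τ) {a : ℕ} {Ψ : State V n}
    (hΨ : Ψ ∈ magnonSpace V n a) (σ : V → Fin (n + 1)) : hamiltonian G n Ψ σ =
      (1 / 2 : ℂ) *
        ∑ t, spinSum (τ t) (lowering n) (spinSum (τ t) (raising n) Ψ) σ +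
      (3 * Fintype.card ι * ((n : ℂ) / 2) ^ 2 - 6 * ((n : ℂ) / 2) * a +
        (1 / 2) * ∑ t, (((∑ u ∈ τ t, (σ u).val : ℕ) : ℂ) ^ 2 - (∑ u ∈ τ t, (σ u).val : ℕ))) *
        Ψ σ := by
  -- The factor `Ψ σ` is needed since `σ` has `a` magnons only where `Ψ` does not vanish.
  have hk : Ψ σ * ∑ t, ((∑ u ∈ τ t, (σ u).val : ℕ) : ℂ) = Ψ σ * (2 * a) := by
    by_cases hσ : Ψ σ = 0
    · simp [hσ]
    · have h1 := h.sum_sum fun u => (σ u).val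
      rw [mem_magnonSpace_iff.mp hΨ σ hσ] at h1
      rw [← Nat.cast_sum, h1]
      simp
  rw [h.hamiltonian_eq]
  simp only [casimir_eq, LinearMap.smul_apply, LinearMap.sum_apply, LinearMap.sub_apply,
    LinearMap.add_apply, Module.End.mul_apply, Pi.smul_apply, Finset.sum_apply, Pi.sub_apply,
    Pi.add_apply, spinSum_z_apply, Module.End.one_apply, smul_eq_mul, h.card_eq]
  generalize hx : (fun t => ((∑ u ∈ τ t, (σ u).val : ℕ) : ℂ)) = x at hk
  have hx' : ∀ t, ((∑ u ∈ τ t, (σ u).val : ℕ) : ℂ) = x t := fun t => congrFun hx t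
  simp only [hx'] at hk ⊢
  generalize hy : (fun t => spinSum (τ t) (lowering n) (spinSum (τ t) (raising n) Ψ) σ) = y
  have hy' : ∀ t, spinSum (τ t) (lowering n) (spinSum (τ t) (raising n) Ψ) σ = y t :=
    fun t => congrFun hy t
  simp only [hy']
  have e : ∀ t, y t + ((3 : ℕ) * ((n : ℂ) / 2) - x t) * (((3 : ℕ) * ((n : ℂ) / 2) - x t) * Ψ σ) +
      ((3 : ℕ) * ((n : ℂ) / 2) - x t) * Ψ σ - 3 * ((n : ℂ) / 2 * ((n : ℂ) / 2 + 1)) * Ψ σ =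
      y t + (x t ^ 2 - x t) * Ψ σ - 6 * ((n : ℂ) / 2) * (Ψ σ * x t) +
        6 * ((n : ℂ) / 2) ^ 2 * Ψ σ := by
    intro t
    push_cast
    ring
  simp only [e, Finset.sum_add_distrib, Finset.sum_sub_distrib, ← Finset.mul_sum, ← Finset.sum_mul,
    Finset.sum_const, nsmul_eq_mul, Finset.card_univ] at hk ⊢
  rw [hk]
  ring

theorem IsTriangleCover.hamiltonian_of_mem_isolatedSpace (h : IsTriangleCover G τ) (hn : 1 ≤ n)
    {a : ℕ} {Ψ : State V n} (hΨ : Ψ ∈ isolatedSpace G n a) : hamiltonian G n Ψ =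
      (1 / 2 : ℂ) • ∑ t, spinSum (τ t) (lowering n) (spinSum (τ t) (raising n) Ψ) +
        (3 * Fintype.card ι * ((n : ℂ) / 2) ^ 2 - 6 * ((n : ℂ) / 2) * a) • Ψ := by
  funext σ
  rw [h.hamiltonian_apply (isolatedSpace_le_magnonSpace hn G a hΨ)]
  simp only [Pi.add_apply, Pi.smul_apply, smul_eq_mul, Finset.sum_apply]
  by_cases hσ : Ψ σ = 0
  · simp [hσ]
  · obtain ⟨A, -, hA, rfl⟩ := exists_of_mem_isolatedSpace hΨ hσ
    rw [Finset.sum_eq_zero (s := Finset.univ) (f := fun t =>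
      ((∑ u ∈ τ t, (flipped n A u).val : ℕ) : ℂ) ^ 2 - (∑ u ∈ τ t, (flipped n A u).val : ℕ)),
      mul_zero, add_zero]
    intro t _
    rw [sum_flipped_val hn]
    -- Two sites of a triangle are neighbours, so an independent set contains at most one of them;
    -- then `k² - k = 0`.
    have hc : (τ t ∩ A).card ≤ 1 := by
      rw [Finset.card_le_one]
      intro u hu v hv
      rw [Finset.mem_inter] at hu hv
      by_contra huv
      exact hA hu.2 hv.2 huv (h.adj huv hu.1 hv.1)
    interval_cases (τ t ∩ A).card <;> norm_num

/-- On isolated states which are annihilated by the raising operators of the triangles, the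
Hamiltonian acts as a scalar. -/
theorem IsTriangleCover.hamiltonian_of_raising_eq_zero (h : IsTriangleCover G τ) (hn : 1 ≤ n)
    {a : ℕ} {Ψ : State V n} (hΨ : Ψ ∈ isolatedSpace G n a)
    (h0 : ∀ t, spinSum (τ t) (raising n) Ψ = 0) : hamiltonian G n Ψ =
      (3 * Fintype.card ι * ((n : ℂ) / 2) ^ 2 - 6 * ((n : ℂ) / 2) * a) • Ψ := by
  simp [h.hamiltonian_of_mem_isolatedSpace hn hΨ, h0]

/-! ### The lower bound for the energies of the magnon spaces -/

open scoped ComplexOrder in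
theorem nonneg_of_ofReal_mul_nonneg {r : ℝ} {z : ℂ} (hz : 0 < z) (h : 0 ≤ (r : ℂ) * z) :
    0 ≤ r := by
  rw [Complex.pos_iff] at hz
  rw [Complex.nonneg_iff, Complex.re_ofReal_mul] at h
  exact nonneg_of_mul_nonneg_left h.1 hz.1

-- In the expectation value of `H`, the terms `S_t⁻S_t⁺` give the squared norms of `S_t⁺Ψ`, and `k²
-- ≥ k` for natural numbers `k`.
open scoped ComplexOrder in
theorem IsTriangleCover.energy_ge (h : IsTriangleCover G τ) {a : ℕ} {E : ℝ}
    (hE : E ∈ magnonEnergies G n a) :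
    3 * Fintype.card ι * ((n : ℝ) / 2) ^ 2 - 6 * ((n : ℝ) / 2) * a ≤ E := by
  obtain ⟨Ψ, hΨ, hE, hΨ0⟩ := hE
  rw [Module.End.mem_eigenspace_iff] at hE
  have hpos : 0 < star Ψ ⬝ᵥ Ψ := Matrix.dotProduct_star_self_pos_iff.mpr hΨ0
  set E₀ : ℝ := 3 * Fintype.card ι * ((n : ℝ) / 2) ^ 2 - 6 * ((n : ℝ) / 2) * a with hE₀
  have key : ((E - E₀ : ℝ) : ℂ) * (star Ψ ⬝ᵥ Ψ) =
      (1 / 2 : ℂ) * (∑ t, star (spinSum (τ t) (raising n) Ψ) ⬝ᵥ spinSum (τ t) (raising n) Ψ) +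
        (1 / 2 : ℂ) * ∑ σ, (∑ t, (((∑ u ∈ τ t, (σ u).val : ℕ) : ℂ) ^ 2 -
          (∑ u ∈ τ t, (σ u).val : ℕ))) * (star (Ψ σ) * Ψ σ) := by
    have h1 : star Ψ ⬝ᵥ hamiltonian G n Ψ = (E : ℂ) * (star Ψ ⬝ᵥ Ψ) := by
      rw [hE, dotProduct_smul, smul_eq_mul]
    have h2 : ∀ t, star (spinSum (τ t) (raising n) Ψ) ⬝ᵥ spinSum (τ t) (raising n) Ψ =
        ∑ σ, star (Ψ σ) * spinSum (τ t) (lowering n) (spinSum (τ t) (raising n) Ψ) σ := by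
      intro t
      rw [star_spinSum_dotProduct, conjTranspose_raising]
      rfl
    rw [Complex.ofReal_sub, sub_mul, ← h1]
    simp only [h2]
    simp only [dotProduct, h.hamiltonian_apply hΨ]
    rw [Finset.sum_comm, Finset.mul_sum, Finset.mul_sum, Finset.mul_sum, ← Finset.sum_sub_distrib,
      ← Finset.sum_add_distrib]
    refine Finset.sum_congr rfl fun σ _ => ?_
    rw [← Finset.mul_sum, Pi.star_apply, hE₀]
    push_cast
    ring
  have hnonneg : (0 : ℂ) ≤ ((E - E₀ : ℝ) : ℂ) * (star Ψ ⬝ᵥ Ψ) := by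
    rw [key]
    have half : (0 : ℂ) ≤ 1 / 2 := by simp
    refine add_nonneg (mul_nonneg half (Finset.sum_nonneg fun t _ =>
      dotProduct_star_self_nonneg _)) (mul_nonneg half (Finset.sum_nonneg fun σ _ =>
        mul_nonneg (Finset.sum_nonneg fun t _ => ?_) (star_mul_self_nonneg _)))
    generalize ∑ u ∈ τ t, (σ u).val = k
    have hk : k ≤ k ^ 2 := Nat.le_self_pow two_ne_zero k
    rw [sub_nonneg]
    exact_mod_cast hk
  have h3 := nonneg_of_ofReal_mul_nonneg hpos hnonneg
  linarith

/-! ### Total spin -/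

/-- For each triangle, the total operator splits into its part on the triangle, covered by the
assumption, and its part on the complement, which commutes because the sites are disjoint. -/
theorem IsTriangleCover.commute_of_forall (h : IsTriangleCover G τ)
    {A : Matrix (Fin (n + 1)) (Fin (n + 1)) ℂ}
    (hA : ∀ t : Finset V, Commute (casimir n t) (spinSum t A)) :
    Commute (hamiltonian G n) (spinSum Finset.univ A) := by
  rw [h.hamiltonian_eq]
  refine Commute.smul_left (Commute.sum_left _ _ _ fun t _ => Commute.sub_left ?_
    (Commute.smul_left (Commute.one_left _) _)) _
  have h1 : spinSum Finset.univ A = spinSum (τ t) A + spinSum (τ t)ᶜ A :=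
    (Finset.sum_add_sum_compl _ _).symm
  rw [h1]
  refine (hA (τ t)).add_right (Commute.sum_left _ _ _ fun i _ => Commute.mul_left ?_ ?_) <;>
  exact spinSum_disjoint_commute disjoint_compl_right _ _

theorem raising_mem_magnonSpace {a : ℕ} {Ψ : State V n} (hΨ : Ψ ∈ magnonSpace V n (a + 1)) :
    spinSum Finset.univ (raising n) Ψ ∈ magnonSpace V n a := by
  rw [magnonSpace, Module.End.mem_eigenspace_iff, totalSpin_eq] at hΨ ⊢
  rw [← Module.End.mul_apply, spinSum_z_raising, LinearMap.add_apply, Module.End.mul_apply, hΨ,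
    map_smul]
  push_cast
  module

theorem raising_eq_zero_of_mem_magnonSpace {Ψ : State V n} (hΨ : Ψ ∈ magnonSpace V n 0) :
    spinSum Finset.univ (raising n) Ψ = 0 := by
  rw [magnonSpace, Module.End.mem_eigenspace_iff, totalSpin_eq] at hΨ
  have h1 : spinSum Finset.univ (spinMatrix n 2) (spinSum Finset.univ (raising n) Ψ) =
      ((Fintype.card V : ℂ) * ((n : ℂ) / 2) + 1) • spinSum Finset.univ (raising n) Ψ := by
    rw [← Module.End.mul_apply, spinSum_z_raising, LinearMap.add_apply, Module.End.mul_apply, hΨ,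
      map_smul]
    push_cast
    module
  funext σ
  have h2 := congrFun h1 σ
  rw [spinSum_z_apply, Pi.smul_apply, smul_eq_mul, mul_eq_mul_right_iff, Finset.card_univ] at h2
  refine h2.resolve_left fun h3 => ?_
  -- The raised state would have `S_z = Ns + 1`, beyond the maximum `Ns`; in a configuration of its
  -- support the deviation would be `-1`.
  have h4 : ((∑ u, (σ u).val + 1 : ℕ) : ℂ) = 0 := by
    push_cast
    push_cast at h3
    linear_combination -h3
  exact absurd (Nat.cast_eq_zero.mp h4) (by omega)

theorem totalSpinSq_of_raising_eq_zero {a : ℕ} {Ψ : State V n} (hΨ : Ψ ∈ magnonSpace V n a)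
    (h0 : spinSum Finset.univ (raising n) Ψ = 0) : totalSpinSq V n Ψ =
      (((Fintype.card V : ℂ) * ((n : ℂ) / 2) - a) *
        ((Fintype.card V : ℂ) * ((n : ℂ) / 2) - a + 1)) • Ψ := by
  rw [magnonSpace, Module.End.mem_eigenspace_iff, totalSpin_eq] at hΨ
  rw [totalSpinSq_eq, casimir_eq]
  simp only [LinearMap.add_apply, Module.End.mul_apply, h0, hΨ, map_smul, map_zero]
  module

-- For a highest-weight vector `‖S⁻Ψ‖² = 2M‖Ψ‖²`, where `M` is its `S_z` eigenvalue, hence `M ≥ 0`.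
open scoped ComplexOrder in
theorem le_of_raising_eq_zero {a : ℕ} {Ψ : State V n} (hΨ : Ψ ∈ magnonSpace V n a)
    (hΨ0 : Ψ ≠ 0) (h0 : spinSum Finset.univ (raising n) Ψ = 0) :
    (a : ℝ) ≤ Fintype.card V * ((n : ℝ) / 2) := by
  rw [magnonSpace, Module.End.mem_eigenspace_iff, totalSpin_eq] at hΨ
  have hpos : 0 < star Ψ ⬝ᵥ Ψ := Matrix.dotProduct_star_self_pos_iff.mpr hΨ0
  have h1 : star (spinSum Finset.univ (lowering n) Ψ) ⬝ᵥ spinSum Finset.univ (lowering n) Ψ =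
      ((2 * (Fintype.card V * ((n : ℝ) / 2) - a) : ℝ) : ℂ) * (star Ψ ⬝ᵥ Ψ) := by
    rw [star_spinSum_dotProduct, ← raising, ← Module.End.mul_apply, spinSum_raising_lowering,
      LinearMap.add_apply, Module.End.mul_apply, h0, map_zero, zero_add, LinearMap.smul_apply, hΨ,
      smul_smul, dotProduct_smul, smul_eq_mul]
    push_cast
    ring
  have h3 := nonneg_of_ofReal_mul_nonneg hpos (h1 ▸ dotProduct_star_self_nonneg _)
  linarith

/-- Energies for total spin `S = N s - a` are energies of the `a`-magnon space. -/
theorem IsTriangleCover.totalSpinEnergies_subset (h : IsTriangleCover G τ) {a : ℕ}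
    (ha : (a : ℝ) ≤ Fintype.card V * ((n : ℝ) / 2)) :
    totalSpinEnergies G n (Fintype.card V * ((n : ℝ) / 2) - a) ⊆ magnonEnergies G n a := by
  classical
  rintro E ⟨Ψ, hS, hE, hΨ0⟩
  set S : ℝ := Fintype.card V * ((n : ℝ) / 2) - a with hSdef
  set W : Submodule ℂ (State V n) :=
    Module.End.eigenspace (totalSpinSq V n) ((S * (S + 1) : ℝ) : ℂ) ⊓
      Module.End.eigenspace (hamiltonian G n) (E : ℂ) with hW
  have stable : ∀ A : Matrix (Fin (n + 1)) (Fin (n + 1)) ℂ,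
      (∀ t : Finset V, Commute (casimir n t) (spinSum t A)) →
        ∀ Φ ∈ W, spinSum Finset.univ A Φ ∈ W := by
    rintro A hA Φ ⟨h1, h2⟩
    rw [SetLike.mem_coe, Module.End.mem_eigenspace_iff] at h1 h2
    refine ⟨?_, ?_⟩ <;> rw [SetLike.mem_coe, Module.End.mem_eigenspace_iff]
    · rw [totalSpinSq_eq] at h1 ⊢
      rw [← Module.End.mul_apply, (hA Finset.univ).eq, Module.End.mul_apply, h1, map_smul]
    · rw [← Module.End.mul_apply, (h.commute_of_forall hA).eq, Module.End.mul_apply, h2, map_smul]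
  -- `W` is nonzero, finite-dimensional and invariant under `S_z`, so it contains an eigenvector of
  -- `S_z`. Any configuration in its support shows that the eigenvalue has the form `Ns - b`.
  have hex : ∃ b, ∃ Φ ∈ W, Φ ∈ magnonSpace V n b ∧ Φ ≠ 0 := by
    have hz := stable (spinMatrix n 2) casimir_commute_z
    have : Nontrivial W := ⟨⟨⟨Ψ, hS, hE⟩, 0, fun h' => hΨ0 (congrArg Subtype.val h')⟩⟩
    obtain ⟨μ, hμ⟩ := Module.End.exists_eigenvalue
      ((spinSum Finset.univ (spinMatrix n 2)).restrict hz)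
    obtain ⟨Φ, hΦ, hΦ0⟩ := hμ.exists_hasEigenvector
    rw [Module.End.mem_eigenspace_iff] at hΦ
    have h1 : spinSum Finset.univ (spinMatrix n 2) Φ.1 = μ • Φ.1 := congrArg Subtype.val hΦ
    have h2 : Φ.1 ≠ 0 := fun h' => hΦ0 (Subtype.ext h')
    obtain ⟨σ, hσ⟩ : ∃ σ, Φ.1 σ ≠ 0 := Function.ne_iff.mp h2
    refine ⟨∑ u, (σ u).val, Φ.1, Φ.2, ?_, h2⟩
    have h3 := congrFun h1 σ
    rw [spinSum_z_apply, Pi.smul_apply, smul_eq_mul, mul_eq_mul_right_iff, or_iff_left hσ,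
      Finset.card_univ] at h3
    rw [magnonSpace, Module.End.mem_eigenspace_iff, totalSpin_eq, h1, h3]
  -- For minimal `b` the vector is of highest weight: `S⁺Φ` lies in `W` with one magnon fewer, so it
  -- vanishes.
  obtain ⟨Φ, hΦW, hΦ, hΦ0⟩ := Nat.find_spec hex
  have hmin : ∀ b < Nat.find hex, ∀ Φ ∈ W, Φ ∈ magnonSpace V n b → Φ = 0 := by
    intro b hb Φ h1 h2
    by_contra h3
    exact Nat.find_min hex hb ⟨Φ, h1, h2, h3⟩
  generalize Nat.find hex = b at hΦ hmin
  have h0 : spinSum Finset.univ (raising n) Φ = 0 := by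
    rcases b with _ | b
    · exact raising_eq_zero_of_mem_magnonSpace hΦ
    · exact hmin b (Nat.lt_succ_self b) _ (stable _ casimir_commute_raising Φ hΦW)
        (raising_mem_magnonSpace hΦ)
  have hb := le_of_raising_eq_zero hΦ hΦ0 h0
  have h1 := totalSpinSq_of_raising_eq_zero hΦ h0
  rw [Module.End.mem_eigenspace_iff.mp hΦW.1] at h1
  have h2 := smul_left_injective ℂ hΦ0 h1
  set m : ℝ := Fintype.card V * ((n : ℝ) / 2) - b with hm
  have h3 : S * (S + 1) = m * (m + 1) := by
    apply Complex.ofReal_injective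
    rw [h2, hm]
    push_cast
    ring
  -- The root `m = -S - 1` is excluded because `m` and `S` are nonnegative.
  have h4 : (m - S) * (m + S + 1) = 0 := by linear_combination -h3
  rcases mul_eq_zero.mp h4 with h5 | h5
  · have h6 : (b : ℝ) = a := by linarith
    rw [← Nat.cast_inj.mp h6]
    exact ⟨Φ, hΦ, hΦW.2, hΦ0⟩
  · linarith

/-- An eigenstate in the `a`-magnon space, whose energy lies below those of the `a - 1`-magnon
space, has total spin `S = N s - a`. -/
theorem IsTriangleCover.mem_totalSpinEnergies (h : IsTriangleCover G τ) {a : ℕ} {E : ℝ}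
    (hE : E ∈ magnonEnergies G n a)
    (hlt : E < 3 * Fintype.card ι * ((n : ℝ) / 2) ^ 2 - 6 * ((n : ℝ) / 2) * ((a : ℝ) - 1)) :
    E ∈ totalSpinEnergies G n (Fintype.card V * ((n : ℝ) / 2) - a) := by
  obtain ⟨Ψ, hΨ, hE, hΨ0⟩ := hE
  refine ⟨Ψ, ?_, hE, hΨ0⟩
  have h0 : spinSum Finset.univ (raising n) Ψ = 0 := by
    rcases a with _ | a
    · exact raising_eq_zero_of_mem_magnonSpace hΨ
    -- Otherwise `S⁺Ψ` is an eigenstate with the same energy and one magnon fewer, against the lower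
    -- bound there.
    · by_contra hne
      have h1 := h.energy_ge ⟨_, raising_mem_magnonSpace hΨ, ?_, hne⟩ (E := E)
      · push_cast at hlt
        simp only [add_sub_cancel_right] at hlt
        linarith
      · rw [Module.End.mem_eigenspace_iff] at hE ⊢
        rw [← Module.End.mul_apply, (h.commute_of_forall casimir_commute_raising).eq,
          Module.End.mul_apply, hE, map_smul]
  rw [Module.End.mem_eigenspace_iff, totalSpinSq_of_raising_eq_zero hΨ h0]
  push_cast
  rfl

end TriangleCover

/-! ### One magnon -/

section OneMagnon

variable {V : Type} [Fintype V] [DecidableEq V] {n : ℕ} {ι : Type} [Fintype ι]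
  {G : SimpleGraph V} [DecidableRel G.Adj] {τ : ι → Finset V}

/-- The one-magnon state with given amplitudes. -/
noncomputable def magnon (n : ℕ) : (V → ℂ) →ₗ[ℂ] State V n where
  toFun f := ∑ u, f u • ket n {u}
  map_add' f g := by simp only [Pi.add_apply, add_smul, Finset.sum_add_distrib]
  map_smul' c f := by
    simp only [Pi.smul_apply, smul_eq_mul, mul_smul, Finset.smul_sum, RingHom.id_apply]

theorem magnon_apply (f : V → ℂ) : magnon n f = ∑ u, f u • ket n {u} := rfl

theorem magnon_apply_flipped (hn : 1 ≤ n) (f : V → ℂ) (u : V) :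
    magnon n f (flipped n {u}) = f u := by
  simp [magnon_apply, ket_apply_flipped hn]

theorem magnon_injective (hn : 1 ≤ n) :
    Function.Injective (magnon n : (V → ℂ) →ₗ[ℂ] State V n) := by
  intro f g h
  funext u
  rw [← magnon_apply_flipped hn f, h, magnon_apply_flipped hn]

theorem magnon_mem_isolatedSpace (G : SimpleGraph V) (f : V → ℂ) :
    magnon n f ∈ isolatedSpace G n 1 := by
  refine Submodule.sum_mem _ fun u _ => Submodule.smul_mem _ _ (Submodule.subset_span ?_)
  exact ⟨{u}, Finset.card_singleton u, by simp [SimpleGraph.isIndepSet_iff], rfl⟩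

theorem range_magnon (hn : 1 ≤ n) :
    LinearMap.range (magnon n : (V → ℂ) →ₗ[ℂ] State V n) = magnonSpace V n 1 := by
  apply le_antisymm
  · rintro _ ⟨f, rfl⟩
    -- A single site is independent in every graph; the empty graph is an arbitrary choice.
    exact isolatedSpace_le_magnonSpace hn ⊥ 1 (magnon_mem_isolatedSpace ⊥ f)
  · intro Ψ hΨ
    refine ⟨fun u => Ψ (flipped n {u}), ?_⟩
    rw [mem_magnonSpace_iff] at hΨ
    have h1 : ∀ σ : V → Fin (n + 1), ∑ u, (σ u).val = 1 → ∃ u, σ = flipped n {u} := by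
      intro σ hσ
      obtain ⟨u, -, hu⟩ := Finset.exists_ne_zero_of_sum_ne_zero (hσ ▸ one_ne_zero)
      rw [← Finset.add_sum_erase _ _ (Finset.mem_univ u)] at hσ
      have h0 : ∑ v ∈ Finset.univ.erase u, (σ v).val = 0 := by omega
      rw [Finset.sum_eq_zero_iff] at h0
      refine ⟨u, funext fun v => Fin.ext ?_⟩
      rw [flipped_val hn]
      rcases eq_or_ne v u with rfl | hv
      · rw [if_pos (Finset.mem_singleton_self v)]
        omega
      · rw [if_neg (by simpa using hv)]
        exact h0 v (Finset.mem_erase.mpr ⟨hv, Finset.mem_univ v⟩)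
    funext σ
    by_cases hσ : ∑ u, (σ u).val = 1
    · obtain ⟨u, rfl⟩ := h1 σ hσ
      rw [magnon_apply_flipped hn]
    · have h2 : ∀ Φ ∈ magnonSpace V n 1, Φ σ = 0 := by
        intro Φ hΦ
        by_contra h3
        exact hσ (mem_magnonSpace_iff.mp hΦ σ h3)
      rw [h2 Ψ (mem_magnonSpace_iff.mpr hΨ),
        h2 _ (isolatedSpace_le_magnonSpace hn ⊥ 1 (magnon_mem_isolatedSpace ⊥ _))]

theorem spinSum_raising_magnon (hn : 1 ≤ n) (t : Finset V) (f : V → ℂ) :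
    spinSum t (raising n) (magnon n f) =
      (((Real.sqrt n : ℝ) : ℂ) * ∑ u ∈ t, f u) • ket n ∅ := by
  have h1 : ∀ u, (∑ v ∈ t, if v ∈ ({u} : Finset V) then ket n (({u} : Finset V).erase v) else 0) =
      if u ∈ t then ket n ∅ else 0 := by
    intro u
    simp only [Finset.mem_singleton]
    rw [Finset.sum_ite_eq']
    simp
  simp only [magnon_apply, map_sum, map_smul, spinSum_raising_ket hn, h1]
  rw [mul_smul, Finset.sum_smul, Finset.smul_sum, ← Finset.sum_subset (Finset.subset_univ t)]
  · refine Finset.sum_congr rfl fun u hu => ?_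
    rw [if_pos hu, smul_comm]
  · intro u _ hu
    rw [if_neg hu, smul_zero, smul_zero]

/-- `S_t⁻S_t⁺` maps `|u⟩` with `u ∈ t` to `n ∑ |v⟩`, summed over `v ∈ t`. Over all triangles the
term `v = u` occurs twice and each neighbour once, which gives `n (2 + A)`. Half of this is `2s +
sA`, and `-6s + 2s = -4s`. -/
theorem IsTriangleCover.hamiltonian_magnon (h : IsTriangleCover G τ) (hn : 1 ≤ n) (f : V → ℂ) :
    hamiltonian G n (magnon n f) = magnon n
      ((3 * Fintype.card ι * ((n : ℂ) / 2) ^ 2 - 4 * ((n : ℂ) / 2)) • f +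
        ((n : ℂ) / 2) • (G.adjMatrix ℂ).mulVec f) := by
  have hsq : ((Real.sqrt n : ℝ) : ℂ) * ((Real.sqrt n : ℝ) : ℂ) = n := by
    rw [← Complex.ofReal_mul, Real.mul_self_sqrt (Nat.cast_nonneg n), Complex.ofReal_natCast]
  have h1 : ∑ t, spinSum (τ t) (lowering n) (spinSum (τ t) (raising n) (magnon n f)) =
      (n : ℂ) • magnon n ((2 : ℂ) • f + (G.adjMatrix ℂ).mulVec f) := by
    have h2 : ∀ t, spinSum (τ t) (lowering n) (spinSum (τ t) (raising n) (magnon n f)) =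
        (n : ℂ) • ∑ v ∈ τ t, (f v • ket n {v} + ∑ u ∈ (τ t).erase v, f u • ket n {v}) := by
      intro t
      rw [spinSum_raising_magnon hn, map_smul, spinSum_lowering_ket_empty hn, smul_smul,
        mul_right_comm, hsq, mul_smul, Finset.smul_sum]
      congr 1
      refine Finset.sum_congr rfl fun v hv => ?_
      rw [← Finset.add_sum_erase _ _ hv, add_smul, Finset.sum_smul]
    simp only [h2, ← Finset.smul_sum, Finset.sum_add_distrib]
    rw [h.sum_sum, h.sum_offDiag fun v u => f u • ket n {v}]
    simp only [magnon_apply, Pi.add_apply, Pi.smul_apply, add_smul, Finset.sum_add_distrib,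
      SimpleGraph.adjMatrix_mulVec_apply, Finset.sum_smul, smul_eq_mul, mul_smul,
      ← Finset.smul_sum]
    congr 2
    · module
    · refine Finset.sum_congr rfl fun u _ => ?_
      rw [SimpleGraph.neighborFinset_eq_filter, Finset.sum_filter]
  rw [h.hamiltonian_of_mem_isolatedSpace hn (magnon_mem_isolatedSpace G f), h1, map_add, map_add,
    map_smul, map_smul, map_smul]
  module

theorem IsTriangleCover.hamiltonian_magnon_eq_smul_iff (h : IsTriangleCover G τ) (hn : 1 ≤ n)
    (f : V → ℂ) (x : ℂ) : hamiltonian G n (magnon n f) =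
      (3 * Fintype.card ι * ((n : ℂ) / 2) ^ 2 + (x - 4) * ((n : ℂ) / 2)) • magnon n f ↔
        (G.adjMatrix ℂ).mulVec f = x • f := by
  have hn0 : (n : ℂ) / 2 ≠ 0 := div_ne_zero (Nat.cast_ne_zero.mpr (by omega)) two_ne_zero
  have e : (3 * Fintype.card ι * ((n : ℂ) / 2) ^ 2 - 4 * ((n : ℂ) / 2)) • f +
      ((n : ℂ) / 2) • (G.adjMatrix ℂ).mulVec f -
        (3 * Fintype.card ι * ((n : ℂ) / 2) ^ 2 + (x - 4) * ((n : ℂ) / 2)) • f =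
      ((n : ℂ) / 2) • ((G.adjMatrix ℂ).mulVec f - x • f) := by
    module
  rw [h.hamiltonian_magnon hn, ← map_smul, (magnon_injective hn).eq_iff, ← sub_eq_zero, e,
    smul_eq_zero, or_iff_right hn0, sub_eq_zero]

/-- Since the matrix and `x` are real, the real and the imaginary part of a complex eigenvector
satisfy the same equation, and one of them is nonzero. -/
theorem hasEigenvalue_adjMatrix_iff (x : ℝ) :
    Module.End.HasEigenvalue (Matrix.toLin' (G.adjMatrix ℝ)) x ↔
      ∃ f : V → ℂ, f ≠ 0 ∧ (G.adjMatrix ℂ).mulVec f = (x : ℂ) • f := by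
  constructor
  · intro hx
    obtain ⟨f, hf, hf0⟩ := hx.exists_hasEigenvector
    rw [Module.End.mem_eigenspace_iff, Matrix.toLin'_apply] at hf
    refine ⟨fun u => (f u : ℂ), fun h0 => hf0 (funext fun u => ?_), funext fun u => ?_⟩
    · exact Complex.ofReal_eq_zero.mp (congrFun h0 u)
    · have h1 := congrFun hf u
      rw [SimpleGraph.adjMatrix_mulVec_apply] at h1 ⊢
      rw [← Complex.ofReal_sum, h1]
      simp
  · rintro ⟨f, hf0, hf⟩
    have hre : (G.adjMatrix ℝ).mulVec (fun u => (f u).re) = x • fun u => (f u).re := by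
      funext u
      have h1 := congrArg Complex.re (congrFun hf u)
      rw [SimpleGraph.adjMatrix_mulVec_apply] at h1 ⊢
      simpa using h1
    have him : (G.adjMatrix ℝ).mulVec (fun u => (f u).im) = x • fun u => (f u).im := by
      funext u
      have h1 := congrArg Complex.im (congrFun hf u)
      rw [SimpleGraph.adjMatrix_mulVec_apply] at h1 ⊢
      simpa using h1
    have key : ∀ g : V → ℝ, (G.adjMatrix ℝ).mulVec g = x • g → g ≠ 0 →
        Module.End.HasEigenvalue (Matrix.toLin' (G.adjMatrix ℝ)) x := by
      intro g hg hg0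
      refine Module.End.hasEigenvalue_of_hasEigenvector (x := g) ⟨?_, hg0⟩
      rw [Module.End.mem_eigenspace_iff, Matrix.toLin'_apply, hg]
    by_cases h0 : (fun u => (f u).re) = 0
    · refine key _ him fun h1 => hf0 (funext fun u => Complex.ext ?_ ?_)
      · exact congrFun h0 u
      · exact congrFun h1 u
    · exact key _ hre h0

theorem IsTriangleCover.magnonEnergies_one (h : IsTriangleCover G τ) (hn : 1 ≤ n) :
    magnonEnergies G n 1 = {E : ℝ | ∃ x : ℝ,
      Module.End.HasEigenvalue (Matrix.toLin' (G.adjMatrix ℝ)) x ∧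
        E = 3 * Fintype.card ι * ((n : ℝ) / 2) ^ 2 + (x - 4) * ((n : ℝ) / 2)} := by
  have hn0 : (n : ℝ) / 2 ≠ 0 := div_ne_zero (Nat.cast_ne_zero.mpr (by omega)) two_ne_zero
  have hcast : ∀ x : ℝ, ((3 * Fintype.card ι * ((n : ℝ) / 2) ^ 2 + (x - 4) * ((n : ℝ) / 2) : ℝ) :
      ℂ) = 3 * Fintype.card ι * ((n : ℂ) / 2) ^ 2 + ((x : ℂ) - 4) * ((n : ℂ) / 2) := by
    intro x
    push_cast
    rfl
  ext E
  simp only [hasEigenvalue_adjMatrix_iff]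
  constructor
  · rintro ⟨Ψ, hΨ, hE, hΨ0⟩
    rw [← range_magnon hn] at hΨ
    obtain ⟨f, rfl⟩ := hΨ
    have hx : E = 3 * Fintype.card ι * ((n : ℝ) / 2) ^ 2 +
        ((E - 3 * Fintype.card ι * ((n : ℝ) / 2) ^ 2) / ((n : ℝ) / 2) + 4 - 4) * ((n : ℝ) / 2) := by
      field_simp
      ring
    refine ⟨_, ⟨f, fun h0 => hΨ0 (by rw [h0, map_zero]), ?_⟩, hx⟩
    rw [← h.hamiltonian_magnon_eq_smul_iff hn, ← hcast, ← hx]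
    exact Module.End.mem_eigenspace_iff.mp hE
  · rintro ⟨x, ⟨f, hf0, hf⟩, rfl⟩
    refine ⟨magnon n f, ?_, ?_, ?_⟩
    · rw [← range_magnon hn]
      exact ⟨f, rfl⟩
    · rw [Module.End.mem_eigenspace_iff, hcast, h.hamiltonian_magnon_eq_smul_iff hn, hf]
    · rw [← map_zero (magnon n)]
      exact (magnon_injective hn).ne hf0

/-! ### Incidence matrix and the degeneracy of the one-magnon ground state -/

/-- The incidence matrix of the triangles and the sites. -/
def incidence (τ : ι → Finset V) : Matrix ι V ℂ := Matrix.of fun t u => if u ∈ τ t then 1 else 0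

theorem incidence_mulVec (f : V → ℂ) (t : ι) :
    (incidence τ).mulVec f t = ∑ u ∈ τ t, f u := by
  simp [incidence, Matrix.mulVec, dotProduct]

/-- The entry at `u, v` counts the triangles through both sites: two if `u = v`, one for a bond,
none otherwise. -/
theorem IsTriangleCover.incidence_mul (h : IsTriangleCover G τ) :
    (incidence τ).conjTranspose * incidence τ = G.adjMatrix ℂ + (2 : ℂ) • 1 := by
  ext u v
  have h1 : ((incidence τ).conjTranspose * incidence τ) u v =
      ((Finset.univ.filter fun t => u ∈ τ t ∧ v ∈ τ t).card : ℂ) := by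
    rw [Matrix.mul_apply, Finset.card_filter, Nat.cast_sum]
    refine Finset.sum_congr rfl fun t _ => ?_
    simp only [incidence, Matrix.conjTranspose_apply, Matrix.of_apply]
    by_cases hu : u ∈ τ t <;> by_cases hv : v ∈ τ t <;> simp [hu, hv]
  rw [h1, Matrix.add_apply, SimpleGraph.adjMatrix_apply, Matrix.smul_apply]
  rcases eq_or_ne u v with rfl | huv
  · simp only [and_self, h.card_site]
    simp
  · rw [h.card_bond u v huv, Matrix.one_apply_ne huv]
    split_ifs <;> simp

open scoped ComplexOrder in
theorem IsTriangleCover.adjMatrix_mulVec_iff (h : IsTriangleCover G τ) (f : V → ℂ) :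
    (G.adjMatrix ℂ).mulVec f = (-2 : ℂ) • f ↔ (incidence τ).mulVec f = 0 := by
  rw [← Matrix.conjTranspose_mul_self_mulVec_eq_zero, h.incidence_mul, Matrix.add_mulVec,
    Matrix.smul_mulVec, Matrix.one_mulVec, neg_smul, eq_neg_iff_add_eq_zero]

/-- The ground space is the injective image of the kernel of the incidence matrix, whose dimension
comes from rank-nullity. -/
theorem IsTriangleCover.finrank_ground (h : IsTriangleCover G τ) (hn : 1 ≤ n)
    (hsurj : Function.Surjective (incidence τ).mulVec) :
    Module.finrank ℂ ↥(magnonSpace V n 1 ⊓ Module.End.eigenspace (hamiltonian G n)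
      (3 * Fintype.card ι * ((n : ℂ) / 2) ^ 2 - 6 * ((n : ℂ) / 2))) + Fintype.card ι =
        Fintype.card V := by
  have h1 : magnonSpace V n 1 ⊓ Module.End.eigenspace (hamiltonian G n)
      (3 * Fintype.card ι * ((n : ℂ) / 2) ^ 2 - 6 * ((n : ℂ) / 2)) =
        (LinearMap.ker (incidence τ).mulVecLin).map (magnon n) := by
    have h2 : ∀ f : V → ℂ, magnon n f ∈ Module.End.eigenspace (hamiltonian G n)
        (3 * Fintype.card ι * ((n : ℂ) / 2) ^ 2 - 6 * ((n : ℂ) / 2)) ↔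
          f ∈ LinearMap.ker (incidence τ).mulVecLin := by
      intro f
      rw [Module.End.mem_eigenspace_iff, LinearMap.mem_ker, Matrix.mulVecLin_apply,
        ← h.adjMatrix_mulVec_iff, ← h.hamiltonian_magnon_eq_smul_iff hn]
      rw [show (-2 - 4 : ℂ) = -6 by norm_num, neg_mul, ← sub_eq_add_neg]
    ext Ψ
    rw [Submodule.mem_inf, ← range_magnon hn, Submodule.mem_map]
    constructor
    · rintro ⟨⟨f, rfl⟩, hf⟩
      exact ⟨f, (h2 f).mp hf, rfl⟩
    · rintro ⟨f, hf, rfl⟩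
      exact ⟨⟨f, rfl⟩, (h2 f).mpr hf⟩
  rw [h1, (Submodule.equivMapOfInjective (magnon n) (magnon_injective hn) _).finrank_eq.symm]
  have h3 := LinearMap.finrank_range_add_finrank_ker (incidence τ).mulVecLin
  rw [LinearMap.range_eq_top.mpr hsurj, finrank_top, Module.finrank_fintype_fun_eq_card,
    Module.finrank_fintype_fun_eq_card] at h3
  omega

end OneMagnon

/-! ### Combinatorics of the icosidodecahedron -/

/-- The triangles of the icosidodecahedron. -/
def triangle : Fin 20 → Finset (Fin 30) :=
  ![{1, 2, 6}, {2, 3, 7}, {3, 4, 8}, {4, 5, 9}, {5, 1, 10},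
    {6, 20, 11}, {7, 12, 13}, {8, 14, 15}, {9, 16, 17}, {10, 18, 19},
    {21, 11, 12}, {22, 13, 14}, {23, 15, 16}, {24, 17, 18}, {25, 19, 20},
    {21, 26, 27}, {22, 27, 28}, {23, 28, 29}, {24, 29, 30}, {25, 30, 26}]

/-- Five consecutive sites of a pentagon, of which the first and the last belong to the given
triangle. -/
def oddPath : Fin 20 → Fin 5 → Fin 30 :=
  ![![1, 5, 4, 3, 2], ![2, 1, 5, 4, 3], ![3, 2, 1, 5, 4], ![4, 3, 2, 1, 5], ![1, 2, 3, 4, 5],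
    ![6, 2, 7, 12, 11], ![7, 2, 6, 11, 12], ![8, 3, 7, 13, 14], ![9, 4, 8, 15, 16],
    ![10, 5, 9, 17, 18],
    ![11, 6, 2, 7, 12], ![13, 7, 3, 8, 14], ![15, 8, 4, 9, 16], ![17, 9, 5, 10, 18],
    ![19, 10, 1, 6, 20],
    ![21, 11, 20, 25, 26], ![22, 13, 12, 21, 27], ![23, 15, 14, 22, 28], ![30, 25, 19, 18, 24],
    ![30, 24, 18, 19, 25]]

theorem isTriangleCover_icosidodecahedron : IsTriangleCover icosidodecahedron triangle where
  card_eq := by decide +kernel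
  card_site := by decide +kernel
  card_bond := by decide +kernel

/-- The signs alternate along a 5-ring, so they cancel on the triangle of every side except the
closing one. There both ends carry `+1`, because the ring is odd. -/
theorem sum_oddPath (t t' : Fin 20) :
    ∑ k, (if oddPath t k ∈ triangle t' then (-1 : ℤ) ^ k.val else 0) = if t = t' then 2 else 0 := by
  revert t t'
  decide +kernel

/-! ### Distance classes as decimal digits -/

/-- The squared distances which occur between sites. -/
def squaredDistances : List (ℤ√5) :=
  [0, 16, ⟨24, 8⟩, ⟨40, 8⟩, ⟨48, 16⟩, ⟨56, 24⟩, ⟨72, 24⟩, ⟨80, 32⟩, ⟨96, 32⟩]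

/-- The decimal digits of `distanceRow u` are the indices in `squaredDistances` of the squared
distances of the sites from `u`. -/
def distanceRow : Fin 30 → ℕ :=
  ![122111343322345665445775678760, 787645775223456654313431122106,
    876657754345665432234311221017, 766777545566543223443113210128,
    667875457654322345631134101227, 678754577432234566511343012216,
    775436863124677642125520343115, 754568633467764211255202431137,
    545786336776421124652025311347, 457763368642112467720255113435,
    577533686211246776402552134314, 653226741135787531047621564234,
    642347621357875310167412653245, 532467412578753101376214642356,
    423576214787531013574126532466, 324674126875310135762147423565,
    235662147753101357841267324654, 246541267531013578721476235643,
    356421476310135787512674246532, 465312674101357875314762356422,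
    564214762013578753126741465323, 431125520246776421168633775453,
    311355202677642112486336754574, 113452025764211246763368545773,
    134320255421124677633686457751, 343102552112467764236863577541,
    221013431234566543257754787661, 210134311456654322377545876672,
    101243113665432234575457766782, 12231134543223456654577667871]

/-- The index in `squaredDistances` of the squared distance of two sites. -/
def distClass (u v : Fin 30) : ℕ := distanceRow u / 10 ^ v.val % 10

theorem idxOf_sqDist (u v : Fin 30) : squaredDistances.idxOf (sqDist u v) = distClass u v := by
  revert u v
  decide +kernel

theorem getD_distClass (u v : Fin 30) :
    squaredDistances.getD (distClass u v) 0 = sqDist u v := by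
  revert u v
  decide +kernel

/-- Replaces comparisons in `ℤ[√5]` by comparisons of digits, so that the finite checks below are
feasible. -/
theorem sqDist_eq_iff (u v u' v' : Fin 30) :
    sqDist u v = sqDist u' v' ↔ distClass u v = distClass u' v' := by
  constructor
  · intro h
    rw [← idxOf_sqDist, ← idxOf_sqDist, h]
  · intro h
    rw [← getD_distClass, ← getD_distClass, h]

theorem icosidodecahedron_adj_iff_distClass (u v : Fin 30) :
    icosidodecahedron.Adj u v ↔ distClass u v = 1 :=
  sqDist_eq_iff u v 1 2

theorem card_commonNeighbors_le {u v : Fin 30} (h : u ≠ v) :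
    (Finset.univ.filter fun w => distClass u w = 1 ∧ distClass v w = 1).card ≤ 1 := by
  revert u v
  decide +kernel

/-! ### The symmetry group -/

/-- A rotation by the angle `2π/5`. -/
def rotation : Fin 30 → Fin 30 :=
  ![26, 2, 3, 4, 5, 1, 7, 8, 9, 10, 6, 13, 14, 15, 16, 17, 18, 19, 20, 11, 12, 22, 23, 24, 25, 21,
    27, 28, 29, 30]

/-- The cyclic permutation of the coordinates. -/
def cycle : Fin 30 → Fin 30 :=
  ![29, 12, 7, 2, 6, 11, 13, 3, 1, 20, 21, 14, 8, 4, 5, 10, 19, 25, 26, 27, 22, 15, 9, 18, 30, 28,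
    23, 16, 17, 24]

/-- The reflections which change the sign of one coordinate. -/
def reflection : Fin 3 → Fin 30 → Fin 30 :=
  ![![15, 1, 6, 20, 19, 10, 2, 11, 25, 18, 5, 7, 12, 21, 26, 30, 24, 17, 9, 4, 3, 13, 27, 29, 16, 8,
      14, 22, 28, 23],
    ![26, 1, 5, 4, 3, 2, 10, 9, 8, 7, 6, 18, 17, 16, 15, 14, 13, 12, 11, 20, 19, 24, 23, 22, 21, 25,
      30, 29, 28, 27],
    ![19, 28, 22, 14, 15, 23, 27, 13, 8, 16, 29, 21, 12, 7, 3, 4, 9, 17, 24, 30, 26, 11, 2, 5, 18,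
      25, 20, 6, 1, 10]]

/-- The elements of the symmetry group, as products of rotations and reflections. -/
def symmetries : List (Fin 30 → Fin 30) :=
  (List.range 5).flatMap fun i => (List.range 3).flatMap fun j => (List.range 2).flatMap fun k =>
    (List.range 2).flatMap fun l => (List.range 2).map fun m =>
      rotation^[i] ∘ cycle^[j] ∘ (reflection 0)^[k] ∘ (reflection 1)^[l] ∘ (reflection 2)^[m]

theorem distClass_rotation (u v : Fin 30) :
    distClass (rotation u) (rotation v) = distClass u v := by
  revert u v
  decide +kernel

theorem distClass_cycle (u v : Fin 30) : distClass (cycle u) (cycle v) = distClass u v := by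
  revert u v
  decide +kernel

theorem distClass_reflection (i : Fin 3) (u v : Fin 30) :
    distClass (reflection i u) (reflection i v) = distClass u v := by
  revert i u v
  decide +kernel

theorem distClass_iterate {f : Fin 30 → Fin 30} (h : ∀ u v, distClass (f u) (f v) = distClass u v)
    (k : ℕ) (u v : Fin 30) : distClass (f^[k] u) (f^[k] v) = distClass u v := by
  induction k with
  | zero => rfl
  | succ k ih => rw [Function.iterate_succ_apply', Function.iterate_succ_apply', h, ih]

theorem distClass_of_mem_symmetries {f : Fin 30 → Fin 30} (hf : f ∈ symmetries) (u v : Fin 30) :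
    distClass (f u) (f v) = distClass u v := by
  simp only [symmetries, List.mem_flatMap, List.mem_map] at hf
  obtain ⟨i, -, j, -, k, -, l, -, m, -, rfl⟩ := hf
  simp only [Function.comp_apply, distClass_iterate distClass_rotation,
    distClass_iterate distClass_cycle, distClass_iterate (distClass_reflection _)]

theorem eq_of_distClass_eq_zero {u v : Fin 30} (h : distClass u v = 0) : u = v := by
  revert u v
  decide +kernel

theorem mem_symmetryGroup_iff {g : Equiv.Perm (Fin 30)} :
    g ∈ symmetryGroup ↔ ∀ u v, distClass (g u) (g v) = distClass u v :=
  forall_congr' fun _ => forall_congr' fun _ => sqDist_eq_iff _ _ _ _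

/-- The sites `1, 2, 3` determine a symmetry. -/
theorem eq_of_distClass_base {v w : Fin 30} (h1 : distClass v 1 = distClass w 1)
    (h2 : distClass v 2 = distClass w 2) (h3 : distClass v 3 = distClass w 3) : v = w := by
  revert v w
  decide +kernel

/-- A number which encodes the images of the sites `1, 2, 3`. -/
def baseCode (f : Fin 30 → Fin 30) : ℕ := ((f 1).val * 30 + (f 2).val) * 30 + (f 3).val

/-- Class 2 is the diagonal of a pentagon, so `x, y, z` are possible images of the consecutive
pentagon sites `1, 2, 3`. Since these images determine a symmetry, the list `symmetries` is the
whole group. -/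
theorem exists_symmetries_base {x y z : Fin 30} (hxy : distClass x y = 1) (hyz : distClass y z = 1)
    (hxz : distClass x z = 2) : ∃ f ∈ symmetries, f 1 = x ∧ f 2 = y ∧ f 3 = z := by
  revert x y z
  decide +kernel

theorem card_baseCode : (symmetries.map baseCode).toFinset.card = 120 := by
  decide +kernel

theorem baseCode_inj {f g : Fin 30 → Fin 30} (h : baseCode f = baseCode g) :
    f 1 = g 1 ∧ f 2 = g 2 ∧ f 3 = g 3 := by
  have := (f 3).is_lt
  have := (g 3).is_lt
  have := (f 2).is_lt
  have := (g 2).is_lt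
  simp only [baseCode] at h
  simp only [Fin.ext_iff]
  omega

theorem eq_of_base {f g : Fin 30 → Fin 30} (hf : ∀ u v, distClass (f u) (f v) = distClass u v)
    (hg : ∀ u v, distClass (g u) (g v) = distClass u v) (hf' : Function.Surjective f)
    (h : f 1 = g 1 ∧ f 2 = g 2 ∧ f 3 = g 3) : f = g := by
  funext v
  obtain ⟨w, hw⟩ := hf' (g v)
  rw [← hw]
  congr 1
  refine eq_of_distClass_base ?_ ?_ ?_
  · rw [← hf w, hw, h.1, hg]
  · rw [← hf w, hw, h.2.1, hg]
  · rw [← hf w, hw, h.2.2, hg]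

theorem coe_mem_symmetries {g : Equiv.Perm (Fin 30)} (hg : g ∈ symmetryGroup) :
    ⇑g ∈ symmetries := by
  rw [mem_symmetryGroup_iff] at hg
  obtain ⟨f, hf, h⟩ := exists_symmetries_base (x := g 1) (y := g 2) (z := g 3)
    (by rw [hg]; decide +kernel) (by rw [hg]; decide +kernel) (by rw [hg]; decide +kernel)
  rw [eq_of_base hg (distClass_of_mem_symmetries hf) g.surjective
    ⟨h.1.symm, h.2.1.symm, h.2.2.symm⟩]
  exact hf

theorem exists_mem_symmetryGroup {f : Fin 30 → Fin 30} (hf : f ∈ symmetries) :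
    ∃ g ∈ symmetryGroup, ⇑g = f := by
  have hinj : Function.Injective f := by
    intro u v h
    apply eq_of_distClass_eq_zero
    rw [← distClass_of_mem_symmetries hf, h]
    generalize f v = w
    revert w
    decide +kernel
  exact ⟨Equiv.ofBijective f (Finite.injective_iff_bijective.mp hinj),
    mem_symmetryGroup_iff.mpr (distClass_of_mem_symmetries hf), rfl⟩

theorem card_symmetryGroup : Nat.card symmetryGroup = 120 := by
  have hinj : Function.Injective fun g : symmetryGroup => baseCode g := by
    intro g g' h
    exact Subtype.ext (DFunLike.coe_injective (eq_of_base (mem_symmetryGroup_iff.mp g.2)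
      (mem_symmetryGroup_iff.mp g'.2) g.1.surjective (baseCode_inj h)))
  have hrange : Set.range (fun g : symmetryGroup => baseCode g) =
      ((symmetries.map baseCode).toFinset : Set ℕ) := by
    ext m
    simp only [Set.mem_range, List.coe_toFinset, List.mem_map, Set.mem_ofPred_eq]
    constructor
    · rintro ⟨g, rfl⟩
      exact ⟨g.1, coe_mem_symmetries g.2, rfl⟩
    · rintro ⟨f, hf, rfl⟩
      obtain ⟨g, hg, rfl⟩ := exists_mem_symmetryGroup hf
      exact ⟨⟨g, hg⟩, rfl⟩
  rw [← Nat.card_range_of_injective hinj, hrange, Nat.card_coe_set_eq, Set.ncard_coe_finset,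
    card_baseCode]

/-! ### Orbits of sets of sites -/

/-- The number whose binary digits are given by a set of sites. -/
def mask (T : Finset (Fin 30)) : ℕ := ∑ u ∈ T, 2 ^ u.val

theorem mask_injective : Function.Injective mask := by
  intro T T' h
  have h1 : ∀ T : Finset (Fin 30), mask T = ∑ i ∈ T.map Fin.valEmbedding, 2 ^ i := fun T => by
    simp [mask]
  rw [h1, h1] at h
  exact Finset.map_injective _ (Finset.geomSum_injective le_rfl h)

/-- The numbers which represent the sets of the orbit of `T`, possibly with repetitions. -/
def orbitMasks (T : Finset (Fin 30)) : List ℕ :=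
  symmetries.map fun f => ∑ u ∈ T, 2 ^ (f u).val

theorem sum_eq_mask_image {f : Fin 30 → Fin 30} (hf : f ∈ symmetries) (T : Finset (Fin 30)) :
    ∑ u ∈ T, 2 ^ (f u).val = mask (T.image f) := by
  obtain ⟨g, -, rfl⟩ := exists_mem_symmetryGroup hf
  rw [mask, Finset.sum_image g.injective.injOn]

/-- Turns the orbit, defined by an existential over permutations, into a finite list of numbers. -/
theorem mem_siteOrbit_iff {T T' : Finset (Fin 30)} : T' ∈ siteOrbit T ↔ mask T' ∈ orbitMasks T := by
  rw [orbitMasks, List.mem_map]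
  constructor
  · rintro ⟨g, hg, rfl⟩
    exact ⟨g, coe_mem_symmetries hg, sum_eq_mask_image (coe_mem_symmetries hg) T⟩
  · rintro ⟨f, hf, h⟩
    rw [sum_eq_mask_image hf] at h
    obtain ⟨g, hg, rfl⟩ := exists_mem_symmetryGroup hf
    exact ⟨g, hg, (mask_injective h).symm⟩

theorem mem_siteOrbit_self (T : Finset (Fin 30)) : T ∈ siteOrbit T :=
  ⟨1, one_mem _, by simp⟩

theorem mem_siteOrbit_image_iff {T T' : Finset (Fin 30)} {g : Equiv.Perm (Fin 30)}
    (hg : g ∈ symmetryGroup) : T'.image g ∈ siteOrbit T ↔ T' ∈ siteOrbit T := by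
  constructor
  · rintro ⟨k, hk, h⟩
    refine ⟨g⁻¹ * k, mul_mem (inv_mem hg) hk, ?_⟩
    rw [Equiv.Perm.coe_mul, ← Finset.image_image, ← h, Finset.image_image]
    simp [Function.comp_def]
  · rintro ⟨k, hk, rfl⟩
    refine ⟨g * k, mul_mem hg hk, ?_⟩
    rw [Equiv.Perm.coe_mul, ← Finset.image_image]

theorem ncard_siteOrbit (T : Finset (Fin 30)) :
    (siteOrbit T).ncard = (orbitMasks T).toFinset.card := by
  rw [← Set.ncard_image_of_injective _ mask_injective, ← Set.ncard_coe_finset]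
  congr 1
  ext m
  simp only [Set.mem_image, mem_siteOrbit_iff, List.coe_toFinset, Set.mem_ofPred_eq]
  constructor
  · rintro ⟨T', h, rfl⟩
    exact h
  · intro h
    obtain ⟨f, hf, rfl⟩ := List.mem_map.mp h
    exact ⟨T.image f, List.mem_map.mpr ⟨f, hf, sum_eq_mask_image hf T⟩,
      (sum_eq_mask_image hf T).symm⟩

theorem disjoint_siteOrbit {T T' : Finset (Fin 30)} (h : T' ∉ siteOrbit T) :
    Disjoint (siteOrbit T) (siteOrbit T') := by
  rw [Set.disjoint_left]
  rintro U hU ⟨g, hg, rfl⟩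
  exact h ((mem_siteOrbit_image_iff hg).mp hU)

theorem ncard_siteOrbit_table : ∀ row ∈ table, (siteOrbit row.1).ncard = row.2.1 := by
  simp only [ncard_siteOrbit]
  decide +kernel

theorem table_pairwise_notMem :
    table.Pairwise fun row row' => mask row'.1 ∉ orbitMasks row.1 := by
  decide +kernel

theorem table_pairwise_disjoint :
    table.Pairwise fun row row' => Disjoint (siteOrbit row.1) (siteOrbit row'.1) :=
  table_pairwise_notMem.imp fun h => disjoint_siteOrbit fun h' => h (mem_siteOrbit_iff.mp h')

/-! ### The amplitudes of the three-magnon state -/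

theorem tableAmplitude_image {g : Equiv.Perm (Fin 30)} (hg : g ∈ symmetryGroup)
    (T : Finset (Fin 30)) : tableAmplitude (T.image g) = tableAmplitude T := by
  classical
  exact congrArg List.sum (List.map_congr_left fun row _ =>
    if_congr (mem_siteOrbit_image_iff hg) rfl rfl)

theorem sum_map_ite_of_pairwise_disjoint {α β : Type*} {l : List α} {s : α → Set β}
    [∀ a, DecidablePred (· ∈ s a)] (c : α → ℤ)
    (hl : l.Pairwise fun a a' => Disjoint (s a) (s a')) {a : α} (ha : a ∈ l) {b : β}
    (hb : b ∈ s a) : (l.map fun a => if b ∈ s a then c a else 0).sum = c a := by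
  induction l with
  | nil => simp at ha
  | cons a₀ l ih =>
    rw [List.pairwise_cons] at hl
    rw [List.map_cons, List.sum_cons]
    rcases List.mem_cons.mp ha with rfl | ha
    · rw [if_pos hb, List.sum_eq_zero, add_zero]
      intro x hx
      obtain ⟨a', ha', rfl⟩ := List.mem_map.mp hx
      exact if_neg (Set.disjoint_left.mp (hl.1 a' ha') hb)
    · rw [if_neg (Set.disjoint_right.mp (hl.1 a ha) hb), zero_add, ih hl.2 ha]

theorem tableAmplitude_of_mem {row : Finset (Fin 30) × ℕ × ℤ} (hrow : row ∈ table)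
    {T : Finset (Fin 30)} (hT : T ∈ siteOrbit row.1) : tableAmplitude T = row.2.2 := by
  classical
  exact sum_map_ite_of_pairwise_disjoint (s := fun row => siteOrbit row.1)
    (fun row => row.2.2) table_pairwise_disjoint hrow hT

/-- A number which encodes the multiset of the distances in a set of sites. -/
def distanceCode (T : Finset (Fin 30)) : ℕ := ∑ u ∈ T, ∑ v ∈ T, 10 ^ distClass u v

theorem distanceCode_eq_of_mem {T T' : Finset (Fin 30)} (h : T' ∈ siteOrbit T) :
    distanceCode T' = distanceCode T := by
  obtain ⟨g, hg, rfl⟩ := h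
  simp only [distanceCode, Finset.sum_image g.injective.injOn, mem_symmetryGroup_iff.mp hg]

/-- The amplitude of a set of sites, in computable form. -/
def orbitAmplitude (T : Finset (Fin 30)) : ℤ :=
  (table.map fun row =>
    if distanceCode T = distanceCode row.1 ∧ mask T ∈ orbitMasks row.1 then row.2.2 else 0).sum

/-- The comparison of distance codes in `orbitAmplitude` is implied by membership in the orbit; it
is a cheap preliminary test. -/
theorem tableAmplitude_eq (T : Finset (Fin 30)) : tableAmplitude T = orbitAmplitude T := by
  classical
  refine congrArg List.sum (List.map_congr_left fun row _ => if_congr ?_ rfl rfl)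
  rw [← mem_siteOrbit_iff]
  exact ⟨fun h => ⟨distanceCode_eq_of_mem h, h⟩, And.right⟩

theorem exists_of_tableAmplitude_ne_zero {T : Finset (Fin 30)} (hT : tableAmplitude T ≠ 0) :
    ∃ row ∈ table, T ∈ siteOrbit row.1 := by
  by_contra h
  refine hT (List.sum_eq_zero fun x hx => ?_)
  obtain ⟨row, hrow, rfl⟩ := List.mem_map.mp hx
  exact if_neg fun h' => h ⟨row, hrow, h'⟩

theorem table_isolated : ∀ row ∈ table, row.1.card = 3 ∧
    ∀ u ∈ row.1, ∀ v ∈ row.1, distClass u v ≠ 1 := by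
  decide +kernel

/-- A site for each distance from the site `1`. -/
def siteAt (k : ℕ) : Fin 30 := [1, 2, 3, 7, 8, 13, 30, 22, 28].getD k 1

/-- Unordered pairs of sites are classified up to symmetry by their distance, which leaves eight
pairs of distinct sites. -/
theorem exists_symmetries_pair (u v : Fin 30) :
    ∃ f ∈ symmetries, f 1 = u ∧ f (siteAt (distClass u v)) = v ∨
      f 1 = v ∧ f (siteAt (distClass u v)) = u := by
  revert u v
  decide +kernel

/-- The system of linear equations that the amplitudes of the table have to solve: the coefficient
of `S_t⁺Φ₃` at a two-magnon product state, one pair for each distance. -/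
theorem orbitAmplitude_sum_eq_zero : ∀ k ∈ List.range 9, k ≠ 0 → ∀ t : Fin 20,
    ∑ u ∈ triangle t, (if u ∈ ({1, siteAt k} : Finset (Fin 30)) then 0
      else orbitAmplitude (insert u {1, siteAt k})) = 0 := by
  decide +kernel

/-! ### Localized magnons on 8-loops -/

theorem eq_of_adj_of_adj {u v w w' : Fin 30} (h : u ≠ v) (hu : icosidodecahedron.Adj u w)
    (hv : icosidodecahedron.Adj v w) (hu' : icosidodecahedron.Adj u w')
    (hv' : icosidodecahedron.Adj v w') : w = w' := by
  rw [icosidodecahedron_adj_iff_distClass] at hu hv hu' hv'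
  exact Finset.card_le_one.mp (card_commonNeighbors_le h) _ (by simp [hu, hv]) _ (by simp [hu', hv'])

/-- A chord would give the distinct sites `R i` and `R (i + 3)` two common neighbours, `R (i + 2)`
and `R (i + 4)`. -/
theorem IsRing.not_adj {R : Fin 5 → Fin 30} (h : IsRing icosidodecahedron 5 R) (i : Fin 5) :
    ¬ icosidodecahedron.Adj (R i) (R (i + 2)) := by
  intro hc
  have h1 := h.2 (i + 2)
  have h2 := h.2 (i + 3)
  have h3 := h.2 (i + 4)
  rw [add_assoc, show (2 + 1 : Fin 5) = 3 from rfl] at h1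
  rw [add_assoc, show (3 + 1 : Fin 5) = 4 from rfl] at h2
  rw [add_assoc, show (4 + 1 : Fin 5) = 0 from rfl, add_zero] at h3
  have hne : R i ≠ R (i + 3) := fun he => by simpa using h.1 he
  have h4 := h.1 (eq_of_adj_of_adj hne hc h1.symm h3.symm h2)
  exact absurd (add_left_cancel h4) (by decide)

/-- Within one pentagon this is the absence of chords. Where the loop passes between the pentagons,
the two sites at the passage already have `c` as a common neighbour, and the chord would produce a
second one. -/
theorem IsEightLoop.not_adj {L : Fin 8 → Fin 30} (h : IsEightLoop icosidodecahedron L) (i : Fin 8) :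
    ¬ icosidodecahedron.Adj (L i) (L (i + 2)) := by
  obtain ⟨⟨hinj, hL⟩, c, r, h1, h2⟩ := h
  have hM : ∀ j k : Fin 8, j + 1 = k → icosidodecahedron.Adj (L (r + j)) (L (r + k)) := by
    rintro j _ rfl
    rw [← add_assoc]
    exact hL (r + j)
  have hne : ∀ j k : Fin 8, j ≠ k → L (r + j) ≠ L (r + k) :=
    fun j k hjk he => hjk (add_left_cancel (hinj he))
  have a0 : icosidodecahedron.Adj c (L (r + 0)) := by
    rw [add_zero]
    exact h1.2 0
  have a3 : icosidodecahedron.Adj (L (r + 3)) c := h1.2 4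
  have a4 : icosidodecahedron.Adj c (L (r + 4)) := h2.2 0
  have a7 : icosidodecahedron.Adj (L (r + 7)) c := h2.2 4
  have n1 : L (r + 1) ≠ c := fun he => absurd (h1.1 (a₁ := 2) (a₂ := 0) he) (by decide)
  have n2 : L (r + 2) ≠ c := fun he => absurd (h1.1 (a₁ := 3) (a₂ := 0) he) (by decide)
  have n5 : L (r + 5) ≠ c := fun he => absurd (h2.1 (a₁ := 2) (a₂ := 0) he) (by decide)
  have n6 : L (r + 6) ≠ c := fun he => absurd (h2.1 (a₁ := 3) (a₂ := 0) he) (by decide)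
  have key : ∀ j : Fin 8, ¬ icosidodecahedron.Adj (L (r + j)) (L (r + (j + 2))) := by
    intro j
    fin_cases j
    · show ¬ icosidodecahedron.Adj (L (r + 0)) (L (r + 2))
      rw [add_zero]
      exact h1.not_adj 1
    · exact h1.not_adj 2
    · exact fun hc => n2 (eq_of_adj_of_adj (hne 3 4 (by decide)) (hM 2 3 rfl).symm hc.symm a3
        a4.symm)
    · exact fun hc => n5 (eq_of_adj_of_adj (hne 3 4 (by decide)) hc (hM 4 5 rfl) a3 a4.symm)
    · exact h2.not_adj 1
    · exact h2.not_adj 2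
    · exact fun hc => n6 (eq_of_adj_of_adj (hne 7 0 (by decide)) (hM 6 7 rfl).symm hc.symm a7
        a0.symm)
    · exact fun hc => n1 (eq_of_adj_of_adj (hne 7 0 (by decide)) hc (hM 0 1 rfl) a7 a0.symm)
  have := key (i - r)
  rwa [add_sub_cancel, ← add_assoc, add_sub_cancel] at this

/-- By the hypothesis the true entries form cyclic runs of length exactly two, whose signs cancel;
the signs also alternate across the end since 8 is even. -/
theorem alternating_sum_eq_zero (x : Fin 8 → Bool)
    (hx : ∀ i, x (i + 1) = true → x i ≠ x (i + 2)) :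
    ∑ i, (if x i = true then (-1 : ℤ) ^ i.val else 0) = 0 := by
  revert x
  decide +kernel

/-- The two loop bonds at a site lie in different triangles, as there is no chord, and these are all
the triangles through the site. So a triangle containing a loop site contains exactly one of its two
loop neighbours. -/
theorem IsEightLoop.sum_eq_zero {L : Fin 8 → Fin 30} (h : IsEightLoop icosidodecahedron L)
    (t : Fin 20) : ∑ i, (if L i ∈ triangle t then (-1 : ℂ) ^ i.val else 0) = 0 := by
  have hcov := isTriangleCover_icosidodecahedron
  have h1 : ∀ i, L (i + 1) ∈ triangle t → ¬ (L i ∈ triangle t ↔ L (i + 2) ∈ triangle t) := by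
    intro i hi hiff
    have hinj : L i ≠ L (i + 2) := fun he => absurd (h.1.1 he) (by simp)
    obtain ⟨t₁, ht₁⟩ := hcov.exists_of_adj (h.1.2 i)
    obtain ⟨t₂, ht₂⟩ := hcov.exists_of_adj (h.1.2 (i + 1))
    rw [add_assoc, show (1 + 1 : Fin 8) = 2 from rfl] at ht₂
    have hne : t₁ ≠ t₂ := by
      rintro rfl
      exact h.not_adj i (hcov.adj hinj ht₁.1 ht₂.2)
    by_cases hit : L i ∈ triangle t
    · exact h.not_adj i (hcov.adj hinj hit (hiff.mp hit))
    -- If `t` contained neither loop neighbour, the site would lie in three triangles.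
    · have h2 : ({t, t₁, t₂} : Finset (Fin 20)) ⊆
          Finset.univ.filter fun s => L (i + 1) ∈ triangle s := by
        intro s hs
        simp only [Finset.mem_insert, Finset.mem_singleton] at hs
        rw [Finset.mem_filter]
        rcases hs with rfl | rfl | rfl
        · exact ⟨Finset.mem_univ _, hi⟩
        · exact ⟨Finset.mem_univ _, ht₁.2⟩
        · exact ⟨Finset.mem_univ _, ht₂.1⟩
      have h3 := Finset.card_le_card h2
      rw [hcov.card_site, Finset.card_eq_three.mpr ⟨t, t₁, t₂, ?_, ?_, hne, rfl⟩] at h3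
      · omega
      · rintro rfl
        exact hit ht₁.1
      · rintro rfl
        exact hit (hiff.mpr ht₂.2)
  have h2 := alternating_sum_eq_zero (fun i => decide (L i ∈ triangle t)) (by
    intro i hi hc
    exact h1 i (of_decide_eq_true hi) (by simpa using hc))
  simp only [decide_eq_true_eq] at h2
  have h3 := congrArg (Int.cast : ℤ → ℂ) h2
  push_cast at h3
  exact h3

section LoopStates

variable {n : ℕ}

theorem hasEigenvector_of_raising_eq_zero (hn : 1 ≤ n) {a : ℕ} {E : ℝ} {Ψ : State (Fin 30) n}
    (hE : E = 60 * ((n : ℝ) / 2) ^ 2 - 6 * ((n : ℝ) / 2) * a)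
    (hΨ : Ψ ∈ isolatedSpace icosidodecahedron n a) (hΨ0 : Ψ ≠ 0)
    (h0 : ∀ t, spinSum (triangle t) (raising n) Ψ = 0) :
    Module.End.HasEigenvector (hamiltonian icosidodecahedron n) (E : ℂ) Ψ := by
  refine ⟨?_, hΨ0⟩
  rw [Module.End.mem_eigenspace_iff,
    isTriangleCover_icosidodecahedron.hamiltonian_of_raising_eq_zero hn hΨ h0, hE, Fintype.card_fin]
  congr 1
  push_cast
  ring

theorem oneLoopState_mem_isolatedSpace (L : Fin 8 → Fin 30) :
    oneLoopState n L ∈ isolatedSpace icosidodecahedron n 1 := by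
  refine Submodule.sum_mem _ fun i _ => Submodule.smul_mem _ _ (Submodule.subset_span ?_)
  exact ⟨{L i}, Finset.card_singleton _, by simp [SimpleGraph.isIndepSet_iff], rfl⟩

theorem spinSum_raising_ket_singleton (hn : 1 ≤ n) (t : Finset (Fin 30)) (u : Fin 30) :
    spinSum t (raising n) (ket n {u}) =
      ((Real.sqrt n : ℝ) : ℂ) • if u ∈ t then ket n ∅ else 0 := by
  rw [spinSum_raising_ket hn]
  simp only [Finset.mem_singleton]
  rw [Finset.sum_ite_eq']
  simp

theorem spinSum_raising_ket_pair (hn : 1 ≤ n) (t : Finset (Fin 30)) {u v : Fin 30} (huv : u ≠ v) :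
    spinSum t (raising n) (ket n {u, v}) = ((Real.sqrt n : ℝ) : ℂ) •
      ((if u ∈ t then ket n {v} else 0) + if v ∈ t then ket n {u} else 0) := by
  rw [spinSum_raising_ket hn]
  congr 1
  have h1 : ∀ w, (if w ∈ ({u, v} : Finset (Fin 30)) then ket n (({u, v} : Finset (Fin 30)).erase w)
      else 0) = (if w = u then ket n {v} else 0) + if w = v then ket n {u} else 0 := by
    intro w
    have e1 : ({u, v} : Finset (Fin 30)).erase u = {v} :=
      Finset.erase_insert (by simpa using huv)
    have e2 : ({u, v} : Finset (Fin 30)).erase v = {u} := by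
      rw [Finset.pair_comm]
      exact Finset.erase_insert (by simpa using huv.symm)
    rcases eq_or_ne w u with rfl | hu
    · rw [if_pos (Finset.mem_insert_self _ _), if_pos rfl, if_neg huv, e1, add_zero]
    · rcases eq_or_ne w v with rfl | hv
      · rw [if_pos (by simp), if_pos rfl, if_neg hu, e2, zero_add]
      · rw [if_neg (by simp [hu, hv]), if_neg hu, if_neg hv, add_zero]
  simp only [h1, Finset.sum_add_distrib, Finset.sum_ite_eq']

theorem raising_oneLoopState (hn : 1 ≤ n) {L : Fin 8 → Fin 30}
    (hL : IsEightLoop icosidodecahedron L) (t : Fin 20) :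
    spinSum (triangle t) (raising n) (oneLoopState n L) = 0 := by
  have h1 : ∑ i, (-1 : ℂ) ^ i.val • (if L i ∈ triangle t then ket n ∅ else 0) =
      (∑ i, if L i ∈ triangle t then (-1 : ℂ) ^ i.val else 0) • ket n (∅ : Finset (Fin 30)) := by
    simp only [Finset.sum_smul, ite_smul, smul_ite, zero_smul, smul_zero]
  simp only [oneLoopState, map_sum, map_smul, spinSum_raising_ket_singleton hn,
    smul_comm _ ((Real.sqrt n : ℝ) : ℂ), ← Finset.smul_sum]
  rw [h1, hL.sum_eq_zero, zero_smul, smul_zero]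

theorem oneLoopState_ne_zero (hn : 1 ≤ n) {L : Fin 8 → Fin 30}
    (hL : IsEightLoop icosidodecahedron L) : oneLoopState n L ≠ 0 := by
  intro h0
  have h1 := congrFun h0 (flipped n {L 0})
  simp only [oneLoopState, Finset.sum_apply, Pi.smul_apply, ket_apply_flipped hn,
    Finset.singleton_inj, hL.1.1.eq_iff, Pi.zero_apply] at h1
  simp at h1

theorem LoopDistEq.ne_and_not_adj {L L' : Fin 8 → Fin 30}
    (h : LoopDistEq icosidodecahedron L L' 2) (i j : Fin 8) :
    L i ≠ L' j ∧ ¬ icosidodecahedron.Adj (L i) (L' j) := by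
  have h1 : 2 ≤ icosidodecahedron.dist (L i) (L' j) := h.2 ⟨i, j, rfl⟩
  constructor
  · intro he
    rw [he, SimpleGraph.dist_self] at h1
    omega
  · intro ha
    rw [SimpleGraph.dist_eq_one_iff_adj.mpr ha] at h1
    omega

theorem twoLoopState_mem_isolatedSpace {L L' : Fin 8 → Fin 30}
    (h : LoopDistEq icosidodecahedron L L' 2) :
    twoLoopState n L L' ∈ isolatedSpace icosidodecahedron n 2 := by
  refine Submodule.sum_mem _ fun i _ => Submodule.sum_mem _ fun j _ =>
    Submodule.smul_mem _ _ (Submodule.subset_span ?_)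
  have hij := h.ne_and_not_adj i j
  refine ⟨{L i, L' j}, Finset.card_pair hij.1, ?_, rfl⟩
  rw [Finset.coe_pair, SimpleGraph.isIndepSet_iff, Set.pairwise_pair]
  exact fun _ => ⟨hij.2, fun ha => hij.2 ha.symm⟩

/-- `S_t⁺` removes the magnon from one of the loops; each of the two resulting terms contains the
alternating sum over that loop as a factor. -/
theorem raising_twoLoopState (hn : 1 ≤ n) {L L' : Fin 8 → Fin 30}
    (hL : IsEightLoop icosidodecahedron L) (hL' : IsEightLoop icosidodecahedron L')
    (h : LoopDistEq icosidodecahedron L L' 2) (t : Fin 20) :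
    spinSum (triangle t) (raising n) (twoLoopState n L L') = 0 := by
  have h1 : ∀ i j, spinSum (triangle t) (raising n) (ket n {L i, L' j}) = _ := fun i j =>
    spinSum_raising_ket_pair hn (triangle t) (h.ne_and_not_adj i j).1
  simp only [twoLoopState, map_sum, map_smul, h1, smul_comm _ ((Real.sqrt n : ℝ) : ℂ),
    ← Finset.smul_sum, smul_add, Finset.sum_add_distrib]
  have h2 : ∑ i : Fin 8, ∑ j : Fin 8, ((-1 : ℂ) ^ i.val * (-1 : ℂ) ^ j.val) •
      (if L i ∈ triangle t then ket n {L' j} else 0) =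
        ∑ j : Fin 8, ((∑ i : Fin 8, if L i ∈ triangle t then (-1 : ℂ) ^ i.val else 0) *
          (-1 : ℂ) ^ j.val) • ket n {L' j} := by
    rw [Finset.sum_comm]
    refine Finset.sum_congr rfl fun j _ => ?_
    simp only [Finset.sum_mul, Finset.sum_smul, smul_ite, smul_zero, ite_mul, zero_mul, ite_smul,
      zero_smul]
  have h3 : ∑ i : Fin 8, ∑ j : Fin 8, ((-1 : ℂ) ^ i.val * (-1 : ℂ) ^ j.val) •
      (if L' j ∈ triangle t then ket n {L i} else 0) =
        ∑ i : Fin 8, ((-1 : ℂ) ^ i.val *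
          ∑ j : Fin 8, if L' j ∈ triangle t then (-1 : ℂ) ^ j.val else 0) • ket n {L i} := by
    refine Finset.sum_congr rfl fun i _ => ?_
    simp only [Finset.mul_sum, Finset.sum_smul, smul_ite, smul_zero, mul_ite, mul_zero, ite_smul,
      zero_smul]
  rw [h2, h3, hL.sum_eq_zero, hL'.sum_eq_zero]
  simp

theorem twoLoopState_ne_zero (hn : 1 ≤ n) {L L' : Fin 8 → Fin 30}
    (hL : IsEightLoop icosidodecahedron L) (hL' : IsEightLoop icosidodecahedron L')
    (h : LoopDistEq icosidodecahedron L L' 2) : twoLoopState n L L' ≠ 0 := by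
  intro h0
  have h1 := congrFun h0 (flipped n {L 0, L' 0})
  have h2 : ∀ i j, ({L 0, L' 0} : Finset (Fin 30)) = {L i, L' j} ↔ i = 0 ∧ j = 0 := by
    intro i j
    constructor
    · intro he
      have hi : L i ∈ ({L 0, L' 0} : Finset (Fin 30)) := he ▸ Finset.mem_insert_self _ _
      have hj : L' j ∈ ({L 0, L' 0} : Finset (Fin 30)) := by
        rw [he]
        simp
      simp only [Finset.mem_insert, Finset.mem_singleton] at hi hj
      exact ⟨hL.1.1 (hi.resolve_right (h.ne_and_not_adj i 0).1),
        hL'.1.1 (hj.resolve_left (h.ne_and_not_adj 0 j).1.symm)⟩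
    · rintro ⟨rfl, rfl⟩
      rfl
  simp only [twoLoopState, Finset.sum_apply, Pi.smul_apply, ket_apply_flipped hn, h2,
    Pi.zero_apply] at h1
  simp [ite_and] at h1

end LoopStates

/-! ### The three-magnon state -/

section TableState

variable {n : ℕ}

theorem tableState_apply_flipped (hn : 1 ≤ n) (T : Finset (Fin 30)) :
    tableState n (flipped n T) = if T.card = 3 then (tableAmplitude T : ℂ) else 0 := by
  simp only [tableState, Finset.sum_apply, Pi.smul_apply, ket_apply_flipped hn, smul_eq_mul,
    mul_ite, mul_one, mul_zero]
  rw [Finset.sum_ite_eq]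
  simp [Finset.mem_powersetCard]

theorem card_of_mem_siteOrbit {T T' : Finset (Fin 30)} (h : T' ∈ siteOrbit T) :
    T'.card = T.card := by
  obtain ⟨g, -, rfl⟩ := h
  exact Finset.card_image_of_injective _ g.injective

theorem tableState_apply_of_mem (hn : 1 ≤ n) {row : Finset (Fin 30) × ℕ × ℤ} (hrow : row ∈ table)
    {T : Finset (Fin 30)} (hT : T ∈ siteOrbit row.1) :
    tableState n (flipped n T) = (row.2.2 : ℂ) := by
  rw [tableState_apply_flipped hn, if_pos, tableAmplitude_of_mem hrow hT]
  rw [card_of_mem_siteOrbit hT, (table_isolated row hrow).1]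

theorem tableState_ne_zero (hn : 1 ≤ n) : tableState n ≠ 0 := by
  intro h0
  have h1 := tableState_apply_of_mem hn (row := ({1, 3, 14}, 60, 1)) List.mem_cons_self
    (mem_siteOrbit_self _)
  rw [h0] at h1
  simp at h1

theorem tableState_mem_isolatedSpace :
    tableState n ∈ isolatedSpace icosidodecahedron n 3 := by
  refine Submodule.sum_mem _ fun T hT => ?_
  by_cases h0 : tableAmplitude T = 0
  · rw [h0, Int.cast_zero, zero_smul]
    exact Submodule.zero_mem _
  · refine Submodule.smul_mem _ _ (Submodule.subset_span ⟨T, (Finset.mem_powersetCard.mp hT).2,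
      ?_, rfl⟩)
    obtain ⟨row, hrow, g, hg, rfl⟩ := exists_of_tableAmplitude_ne_zero h0
    intro u hu v hv _
    rw [Finset.mem_coe, Finset.mem_image] at hu hv
    obtain ⟨u, hu, rfl⟩ := hu
    obtain ⟨v, hv, rfl⟩ := hv
    rw [icosidodecahedron_adj_iff_distClass, mem_symmetryGroup_iff.mp hg]
    exact (table_isolated row hrow).2 u hu v hv

theorem ket_comp {g : Equiv.Perm (Fin 30)} (T : Finset (Fin 30)) (σ : Fin 30 → Fin (n + 1)) :
    ket n T (σ ∘ g) = ket n (T.image g) σ := by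
  have h1 : flipped n (T.image g) ∘ g = flipped n T := by
    funext u
    simp [flipped]
  rw [ket, ket, Pi.single_apply, Pi.single_apply, ← h1]
  have h2 : Function.Injective fun φ : Fin 30 → Fin (n + 1) => φ ∘ g :=
    Function.Surjective.injective_comp_right g.surjective
  exact if_congr h2.eq_iff rfl rfl

theorem tableState_comp {g : Equiv.Perm (Fin 30)} (hg : g ∈ symmetryGroup)
    (σ : Fin 30 → Fin (n + 1)) : tableState n (σ ∘ g) = tableState n σ := by
  simp only [tableState, Finset.sum_apply, Pi.smul_apply, ket_comp]
  refine Finset.sum_equiv g.finsetCongr (fun T => ?_) fun T _ => ?_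
  · simp [Finset.mem_powersetCard]
  · rw [Equiv.finsetCongr_apply, Finset.map_eq_image, Equiv.coe_toEmbedding,
      tableAmplitude_image hg]

theorem exists_triangle_mask :
    symmetries.all fun f => decide (∀ t, ∃ t', mask (triangle t') =
      ∑ u ∈ triangle t, 2 ^ (f u).val) := by
  decide +kernel

theorem exists_triangle_image {g : Equiv.Perm (Fin 30)} (hg : g ∈ symmetryGroup) (t : Fin 20) :
    ∃ t', (triangle t').image g = triangle t := by
  have h1 := coe_mem_symmetries (inv_mem hg)
  obtain ⟨t', h3⟩ := of_decide_eq_true (List.all_eq_true.mp exists_triangle_mask _ h1) t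
  rw [sum_eq_mask_image h1] at h3
  refine ⟨t', ?_⟩
  rw [mask_injective h3, Finset.image_image]
  simp [Function.comp_def]

theorem distClass_lt (u v : Fin 30) : distClass u v < 9 := by
  revert u v
  decide +kernel

theorem exists_image_pair {C : Finset (Fin 30)} (hC : C.card = 2) :
    ∃ g ∈ symmetryGroup, ∃ k ∈ List.range 9, k ≠ 0 ∧
      C = ({1, siteAt k} : Finset (Fin 30)).image g := by
  obtain ⟨u, v, huv, rfl⟩ := Finset.card_eq_two.mp hC
  obtain ⟨f, hf, h⟩ := exists_symmetries_pair u v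
  obtain ⟨g, hg, rfl⟩ := exists_mem_symmetryGroup hf
  refine ⟨g, hg, distClass u v, List.mem_range.mpr (distClass_lt u v),
    fun h0 => huv (eq_of_distClass_eq_zero h0), ?_⟩
  rw [Finset.image_insert, Finset.image_singleton]
  rcases h with ⟨h1, h2⟩ | ⟨h1, h2⟩
  · rw [h1, h2]
  · rw [h1, h2, Finset.pair_comm]

/-- A symmetry carries `C` to a standard pair and permutes the triangles, and the amplitudes are
invariant. -/
theorem tableAmplitude_sum_eq_zero {C : Finset (Fin 30)} (hC : C.card = 2) (t : Fin 20) :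
    ∑ u ∈ triangle t, (if u ∈ C then 0 else tableAmplitude (insert u C)) = 0 := by
  obtain ⟨g, hg, k, hk, hk0, rfl⟩ := exists_image_pair hC
  obtain ⟨t', ht'⟩ := exists_triangle_image hg t
  rw [← ht', Finset.sum_image g.injective.injOn]
  refine Eq.trans ?_ (orbitAmplitude_sum_eq_zero k hk hk0 t')
  refine Finset.sum_congr rfl fun u _ => ?_
  rw [← Finset.image_insert, tableAmplitude_image hg, tableAmplitude_eq]
  exact if_congr (Function.Injective.mem_finset_image g.injective) rfl rfl

theorem raising_tableState (hn : 1 ≤ n) (t : Fin 20) :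
    spinSum (triangle t) (raising n) (tableState n) = 0 := by
  have h1 : ∀ u : Fin 30, ∑ T ∈ Finset.powersetCard 3 Finset.univ,
      (if u ∈ T then (tableAmplitude T : ℂ) • ket n (T.erase u) else 0) =
        ∑ C ∈ Finset.powersetCard 2 Finset.univ,
          ((if u ∈ C then 0 else tableAmplitude (insert u C) : ℤ) : ℂ) • ket n C := by
    intro u
    rw [← Finset.sum_filter, ← Finset.sum_filter_of_ne (s := Finset.powersetCard 2 Finset.univ)
      (p := fun C => u ∉ C)]
    -- Regrouping by the remaining pair `C = T \ {u}` exhibits the coefficient of `ket n C`.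
    · refine Finset.sum_nbij' (fun T => T.erase u) (fun C => insert u C) ?_ ?_ ?_ ?_ ?_
      · intro T hT
        simp only [Finset.mem_filter, Finset.mem_powersetCard_univ] at hT ⊢
        rw [Finset.card_erase_of_mem hT.2, hT.1]
        simp
      · intro C hC
        simp only [Finset.mem_filter, Finset.mem_powersetCard_univ] at hC ⊢
        rw [Finset.card_insert_of_notMem hC.2, hC.1]
        simp
      · intro T hT
        exact Finset.insert_erase (Finset.mem_filter.mp hT).2
      · intro C hC
        exact Finset.erase_insert (Finset.mem_filter.mp hC).2
      · intro T hT
        rw [if_neg (Finset.notMem_erase u T), Finset.insert_erase (Finset.mem_filter.mp hT).2]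
    · intro C _ hne hu
      rw [if_pos hu, Int.cast_zero, zero_smul] at hne
      exact hne rfl
  have h2 : ∀ T : Finset (Fin 30), (tableAmplitude T : ℂ) •
      (∑ u ∈ triangle t, if u ∈ T then ket n (T.erase u) else 0) =
        ∑ u ∈ triangle t, if u ∈ T then (tableAmplitude T : ℂ) • ket n (T.erase u) else 0 := by
    intro T
    simp only [Finset.smul_sum, smul_ite, smul_zero]
  simp only [tableState, map_sum, map_smul, spinSum_raising_ket hn,
    smul_comm _ ((Real.sqrt n : ℝ) : ℂ), ← Finset.smul_sum (r := ((Real.sqrt n : ℝ) : ℂ)), h2]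
  rw [Finset.sum_comm, Finset.sum_congr rfl fun u _ => h1 u, Finset.sum_comm,
    Finset.sum_eq_zero, smul_zero]
  intro C hC
  rw [← Finset.sum_smul, ← Int.cast_sum,
    tableAmplitude_sum_eq_zero (Finset.mem_powersetCard.mp hC).2, Int.cast_zero, zero_smul]

end TableState

/-! ### Energies of the icosidodecahedron -/

section Energies

variable {n : ℕ}

theorem icosidodecahedron_isRegularOfDegree : icosidodecahedron.IsRegularOfDegree 4 := by
  intro v
  rw [← SimpleGraph.card_neighborFinset_eq_degree, SimpleGraph.neighborFinset_eq_filter]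
  simp only [icosidodecahedron_adj_iff_distClass]
  revert v
  decide +kernel

/-- Half of the alternating vector along `oddPath t` is a preimage of the unit vector at `t`. -/
theorem incidence_triangle_surjective : Function.Surjective (incidence triangle).mulVec := by
  intro f
  obtain ⟨p, hp⟩ : ∃ p : Fin 20 → Fin 30 → ℂ,
      ∀ t, p t = ∑ k, (-1 : ℂ) ^ k.val • Pi.single (oddPath t k) 1 := ⟨_, fun _ => rfl⟩
  refine ⟨∑ t, (f t / 2) • p t, funext fun t' => ?_⟩
  have h1 : ∀ t, ∑ u ∈ triangle t', p t u = if t = t' then (2 : ℂ) else 0 := by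
    intro t
    simp only [hp, Finset.sum_apply, Pi.smul_apply, Pi.single_apply, smul_eq_mul, mul_ite, mul_one,
      mul_zero]
    rw [Finset.sum_comm]
    simp only [Finset.sum_ite_eq']
    exact_mod_cast congrArg (Int.cast : ℤ → ℂ) (sum_oddPath t t')
  rw [incidence_mulVec]
  simp only [Finset.sum_apply, Pi.smul_apply, smul_eq_mul]
  rw [Finset.sum_comm]
  simp only [← Finset.mul_sum, h1]
  simp

theorem energy_ge {a : ℕ} {E : ℝ} (hE : E ∈ magnonEnergies icosidodecahedron n a) :
    60 * ((n : ℝ) / 2) ^ 2 - 6 * ((n : ℝ) / 2) * a ≤ E := by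
  refine le_trans (le_of_eq ?_) (isTriangleCover_icosidodecahedron.energy_ge hE)
  rw [Fintype.card_fin]
  norm_num

theorem isLeast_magnonEnergies (hn : 1 ≤ n) {a : ℕ} {E : ℝ} {Ψ : State (Fin 30) n}
    (hE : E = 60 * ((n : ℝ) / 2) ^ 2 - 6 * ((n : ℝ) / 2) * a)
    (hΨ : Ψ ∈ isolatedSpace icosidodecahedron n a) (hΨ0 : Ψ ≠ 0)
    (h0 : ∀ t, spinSum (triangle t) (raising n) Ψ = 0) :
    IsLeast (magnonEnergies icosidodecahedron n a) E :=
  ⟨⟨Ψ, isolatedSpace_le_magnonSpace hn _ _ hΨ, hasEigenvector_of_raising_eq_zero hn hE hΨ hΨ0 h0⟩,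
    fun _ hE' => hE.trans_le (energy_ge hE')⟩

theorem isEightLoop_loop₁ : IsEightLoop icosidodecahedron loop₁ := by
  refine ⟨⟨by decide +kernel, by decide +kernel⟩, 5, 0, ⟨by decide +kernel, by decide +kernel⟩,
    ⟨by decide +kernel, by decide +kernel⟩⟩

theorem isEightLoop_loop₂ : IsEightLoop icosidodecahedron loop₂ := by
  refine ⟨⟨by decide +kernel, by decide +kernel⟩, 27, 3, ⟨by decide +kernel, by decide +kernel⟩,
    ⟨by decide +kernel, by decide +kernel⟩⟩

theorem reachable_one (u : Fin 30) : icosidodecahedron.Reachable 1 u := by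
  -- `(u + 29) % 30` orders the sites as `1, …, 30`, with `30 = 0` last; each site but the first has
  -- a neighbour with a smaller number.
  have h1 : ∀ u : Fin 30, u ≠ 1 →
      ∃ w, distClass w u = 1 ∧ (w.val + 29) % 30 < (u.val + 29) % 30 := by
    decide +kernel
  induction hk : (u.val + 29) % 30 using Nat.strong_induction_on generalizing u with
  | _ k ih =>
    rcases eq_or_ne u 1 with rfl | hu
    · exact .rfl
    · obtain ⟨w, hw, hlt⟩ := h1 u hu
      exact (ih _ (hk ▸ hlt) w rfl).trans
        (SimpleGraph.Adj.reachable ((icosidodecahedron_adj_iff_distClass w u).mpr hw))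

theorem loopDistEq_loop : LoopDistEq icosidodecahedron loop₁ loop₂ 2 := by
  have hne : ∀ i j, loop₁ i ≠ loop₂ j ∧ ¬ icosidodecahedron.Adj (loop₁ i) (loop₂ j) := by
    decide +kernel
  have h17 : icosidodecahedron.Adj 2 7 := by decide +kernel
  have h712 : icosidodecahedron.Adj 7 12 := by decide +kernel
  have hge : ∀ i j, 2 ≤ icosidodecahedron.dist (loop₁ i) (loop₂ j) := by
    intro i j
    obtain ⟨h1, h2⟩ := hne i j
    -- Connectedness matters because `dist` takes the value `0` on unreachable pairs.
    have h3 := (reachable_one (loop₁ i)).symm.trans (reachable_one (loop₂ j))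
    have h4 := h3.pos_dist_of_ne h1
    have h5 : icosidodecahedron.dist (loop₁ i) (loop₂ j) ≠ 1 := fun h =>
      h2 (SimpleGraph.dist_eq_one_iff_adj.mp h)
    omega
  constructor
  -- The distance is attained by the walk `2, 7, 12`.
  · refine ⟨1, 0, le_antisymm (hge 1 0) ?_⟩
    exact SimpleGraph.dist_le (SimpleGraph.Walk.cons h17 (SimpleGraph.Walk.cons h712 .nil))
  · rintro _ ⟨i, j, rfl⟩
    exact hge i j

theorem raising_ket_empty (hn : 1 ≤ n) (t : Finset (Fin 30)) :
    spinSum t (raising n) (ket n (∅ : Finset (Fin 30))) = 0 := by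
  simp [spinSum_raising_ket hn]

theorem ket_empty_mem_isolatedSpace :
    ket n (∅ : Finset (Fin 30)) ∈ isolatedSpace icosidodecahedron n 0 :=
  Submodule.subset_span ⟨∅, Finset.card_empty, by simp [SimpleGraph.isIndepSet_iff], rfl⟩

theorem ket_empty_ne_zero : ket n (∅ : Finset (Fin 30)) ≠ 0 := by
  intro h
  have h1 := congrFun h (flipped n ∅)
  rw [ket, Pi.single_eq_same] at h1
  exact one_ne_zero h1

theorem exists_ground_state (hn : 1 ≤ n) {a : ℕ} (ha : a ≤ 3) :
    ∃ Ψ : State (Fin 30) n, Ψ ∈ isolatedSpace icosidodecahedron n a ∧ Ψ ≠ 0 ∧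
      ∀ t, spinSum (triangle t) (raising n) Ψ = 0 := by
  interval_cases a
  · exact ⟨_, ket_empty_mem_isolatedSpace, ket_empty_ne_zero, fun t => raising_ket_empty hn _⟩
  · exact ⟨_, oneLoopState_mem_isolatedSpace loop₁, oneLoopState_ne_zero hn isEightLoop_loop₁,
      raising_oneLoopState hn isEightLoop_loop₁⟩
  · exact ⟨_, twoLoopState_mem_isolatedSpace loopDistEq_loop,
      twoLoopState_ne_zero hn isEightLoop_loop₁ isEightLoop_loop₂ loopDistEq_loop,
      raising_twoLoopState hn isEightLoop_loop₁ isEightLoop_loop₂ loopDistEq_loop⟩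
  · exact ⟨_, tableState_mem_isolatedSpace, tableState_ne_zero hn, raising_tableState hn⟩

theorem isLeast_magnonEnergies_of_le (hn : 1 ≤ n) {a : ℕ} (ha : a ≤ 3) {E : ℝ}
    (hE : E = 60 * ((n : ℝ) / 2) ^ 2 - 6 * ((n : ℝ) / 2) * a) :
    IsLeast (magnonEnergies icosidodecahedron n a) E := by
  obtain ⟨Ψ, h1, h2, h3⟩ := exists_ground_state hn ha
  exact isLeast_magnonEnergies hn hE h1 h2 h3

theorem isLeast_totalSpinEnergies_of_le (hn : 1 ≤ n) {a : ℕ} (ha : a ≤ 3) {E : ℝ}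
    (hE : E = 60 * ((n : ℝ) / 2) ^ 2 - 6 * ((n : ℝ) / 2) * a) :
    IsLeast (totalSpinEnergies icosidodecahedron n (30 * ((n : ℝ) / 2) - a)) E := by
  have hleast := isLeast_magnonEnergies_of_le hn ha hE
  have hn' : (1 : ℝ) ≤ n := by exact_mod_cast hn
  have ha' : (a : ℝ) ≤ 3 := by exact_mod_cast ha
  have hcard : (Fintype.card (Fin 30) : ℝ) = 30 := by simp
  have hcov := isTriangleCover_icosidodecahedron
  rw [← hcard]
  constructor
  -- The energy lies below the bound for `a - 1` magnons by `6s > 0`.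
  · refine hcov.mem_totalSpinEnergies hleast.1 ?_
    rw [hE, Fintype.card_fin]
    push_cast
    linarith
  -- Here `a ≤ 3 ≤ 15 ≤ 30s`, so the total spin `30s - a` is nonnegative.
  · exact fun E' hE' => hleast.2 (hcov.totalSpinEnergies_subset (by rw [hcard]; linarith) hE')

theorem magnonEnergies_one (hn : 1 ≤ n) : magnonEnergies icosidodecahedron n 1 =
    {E : ℝ | ∃ x : ℝ, Module.End.HasEigenvalue
      (Matrix.toLin' (icosidodecahedron.adjMatrix ℝ)) x ∧
        E = 60 * ((n : ℝ) / 2) ^ 2 + (x - 4) * ((n : ℝ) / 2)} := by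
  rw [isTriangleCover_icosidodecahedron.magnonEnergies_one hn, Fintype.card_fin]
  norm_num

/-- Read off from the one-magnon spectrum for `s = 1/2`, which is an increasing affine function of
the adjacency spectrum with known minimum. -/
theorem isLeast_adjMatrix_eigenvalue : IsLeast {x : ℝ | Module.End.HasEigenvalue
    (Matrix.toLin' (icosidodecahedron.adjMatrix ℝ)) x} (-2) := by
  have h1 := isLeast_magnonEnergies_of_le (n := 1) le_rfl (a := 1) (by norm_num) rfl
  rw [magnonEnergies_one le_rfl] at h1
  obtain ⟨⟨x, hx, hE⟩, h2⟩ := h1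
  constructor
  · have h3 : x = -2 := by
      push_cast at hE
      linarith
    exact h3 ▸ hx
  · intro y hy
    have h3 := h2 ⟨y, hy, rfl⟩
    push_cast at h3
    linarith

theorem finrank_ground (hn : 1 ≤ n) {E : ℝ}
    (hE : E = 60 * ((n : ℝ) / 2) ^ 2 - 6 * ((n : ℝ) / 2)) :
    Module.finrank ℂ ↥(magnonSpace (Fin 30) n 1 ⊓
      Module.End.eigenspace (hamiltonian icosidodecahedron n) (E : ℂ)) = 10 := by
  have h1 := isTriangleCover_icosidodecahedron.finrank_ground hn incidence_triangle_surjective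
  have h2 : (E : ℂ) = 3 * Fintype.card (Fin 20) * ((n : ℂ) / 2) ^ 2 - 6 * ((n : ℂ) / 2) := by
    rw [hE, Fintype.card_fin]
    push_cast
    ring
  rw [← h2, Fintype.card_fin, Fintype.card_fin] at h1
  omega

end Energies

end HighSpin

theorem mainTheorem2 :
    -- the coupling graph and its symmetry group
    icosidodecahedron.IsRegularOfDegree 4 ∧
    Nat.card symmetryGroup = 120 ∧
    -- the least eigenvalue of the adjacency matrix is `-2`
    IsLeast {x : ℝ | Module.End.HasEigenvalue
      (Matrix.toLin' (icosidodecahedron.adjMatrix ℝ)) x} (-2) ∧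
    -- orbit lengths of the table; orbits of different rows are disjoint
    (∀ row ∈ table, (siteOrbit row.1).ncard = row.2.1) ∧
    (table.Pairwise fun row row' => Disjoint (siteOrbit row.1) (siteOrbit row'.1)) ∧
    -- the two loops of the example
    (IsEightLoop icosidodecahedron loop₁ ∧ IsEightLoop icosidodecahedron loop₂ ∧
      LoopDistEq icosidodecahedron loop₁ loop₂ 2) ∧
    -- arbitrary spin `s = n / 2`
    (∀ (n : ℕ), 1 ≤ n → ∀ s : ℝ, s = n / 2 →
      -- no magnon and one magnon: the last two points of the energy graph
      IsLeast (magnonEnergies icosidodecahedron n 0) (60 * s ^ 2) ∧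
      magnonEnergies icosidodecahedron n 1 =
        {E : ℝ | ∃ x : ℝ, Module.End.HasEigenvalue
          (Matrix.toLin' (icosidodecahedron.adjMatrix ℝ)) x ∧ E = 60 * s ^ 2 + (x - 4) * s} ∧
      IsLeast (magnonEnergies icosidodecahedron n 1) (60 * s ^ 2 - 6 * s) ∧
      Module.finrank ℂ ↥(magnonSpace (Fin 30) n 1 ⊓
        Module.End.eigenspace (hamiltonian icosidodecahedron n)
          ((60 * s ^ 2 - 6 * s : ℝ) : ℂ)) = 10 ∧
      -- localized one-magnon states
      (∀ L : Fin 8 → Fin 30, IsEightLoop icosidodecahedron L →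
        oneLoopState n L ∈ magnonSpace (Fin 30) n 1 ∧
        Module.End.HasEigenvector (hamiltonian icosidodecahedron n)
          ((60 * s ^ 2 - 6 * s : ℝ) : ℂ) (oneLoopState n L)) ∧
      -- two magnons on 8-loops with distance 2
      (∀ L L' : Fin 8 → Fin 30, IsEightLoop icosidodecahedron L →
        IsEightLoop icosidodecahedron L' → LoopDistEq icosidodecahedron L L' 2 →
        twoLoopState n L L' ∈ magnonSpace (Fin 30) n 2 ∧
        twoLoopState n L L' ∈ isolatedSpace icosidodecahedron n 2 ∧
        Module.End.HasEigenvector (hamiltonian icosidodecahedron n)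
          ((60 * s ^ 2 - 12 * s : ℝ) : ℂ) (twoLoopState n L L')) ∧
      -- three magnons: the symmetric state of the table
      (∀ row ∈ table, ∀ T ∈ siteOrbit row.1, tableState n (flipped n T) = (row.2.2 : ℂ)) ∧
      (∀ g ∈ symmetryGroup, ∀ σ : Fin 30 → Fin (n + 1),
        tableState n (σ ∘ g) = tableState n σ) ∧
      tableState n ∈ magnonSpace (Fin 30) n 3 ∧
      tableState n ∈ isolatedSpace icosidodecahedron n 3 ∧
      Module.End.HasEigenvector (hamiltonian icosidodecahedron n)
        ((60 * s ^ 2 - 18 * s : ℝ) : ℂ) (tableState n)) ∧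
    -- spin `1/2`: the minimal energies for `a ≤ 3` magnons, and those for total spin
    -- `S = 15, 14, 13, 12`, lie on a straight line
    (∀ a : ℕ, a ≤ 3 → ∀ s : ℝ, s = 1 / 2 →
      IsLeast (magnonEnergies icosidodecahedron 1 a) (60 * s ^ 2 - 6 * s * a) ∧
      IsLeast (totalSpinEnergies icosidodecahedron 1 (30 * s - a)) (60 * s ^ 2 - 6 * s * a)) := by
  refine ⟨icosidodecahedron_isRegularOfDegree, card_symmetryGroup, isLeast_adjMatrix_eigenvalue,
    ncard_siteOrbit_table, table_pairwise_disjoint,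
    ⟨isEightLoop_loop₁, isEightLoop_loop₂, loopDistEq_loop⟩, ?_, ?_⟩
  · rintro n hn s rfl
    refine ⟨isLeast_magnonEnergies_of_le hn (by norm_num) (by push_cast; ring),
      magnonEnergies_one hn,
      isLeast_magnonEnergies_of_le hn (by norm_num) (by push_cast; ring),
      finrank_ground hn rfl, fun L hL => ⟨?_, ?_⟩, fun L L' hL hL' h => ⟨?_, ?_, ?_⟩,
      fun row hrow T hT => tableState_apply_of_mem hn hrow hT,
      fun g hg σ => tableState_comp hg σ, ?_, tableState_mem_isolatedSpace, ?_⟩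
    · exact isolatedSpace_le_magnonSpace hn _ _ (oneLoopState_mem_isolatedSpace L)
    · exact hasEigenvector_of_raising_eq_zero hn (by push_cast; ring)
        (oneLoopState_mem_isolatedSpace L) (oneLoopState_ne_zero hn hL) (raising_oneLoopState hn hL)
    · exact isolatedSpace_le_magnonSpace hn _ _ (twoLoopState_mem_isolatedSpace h)
    · exact twoLoopState_mem_isolatedSpace h
    · exact hasEigenvector_of_raising_eq_zero hn (by push_cast; ring)
        (twoLoopState_mem_isolatedSpace h) (twoLoopState_ne_zero hn hL hL' h)
        (raising_twoLoopState hn hL hL' h)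
    · exact isolatedSpace_le_magnonSpace hn _ _ tableState_mem_isolatedSpace
    · exact hasEigenvector_of_raising_eq_zero hn (by push_cast; ring)
        tableState_mem_isolatedSpace (tableState_ne_zero hn) (raising_tableState hn)
  · rintro a ha s rfl
    have h1 : (1 / 2 : ℝ) = ((1 : ℕ) : ℝ) / 2 := by norm_num
    rw [h1]
    exact ⟨isLeast_magnonEnergies_of_le le_rfl ha rfl, isLeast_totalSpinEnergies_of_le le_rfl ha rfl⟩
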